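/- **Model.** A fork-join queueing network with blocking (FJQN/B) $N=(V,E)$ is a finite directed acyclic graph whose underlying undirected graph $G$ is connected; every arc carries a buffer of the same finite capacity $b\ge 1$, empty at time $0$. Given service times $S_{m,v}\ge 0$ ($m=0,1,2,\dots$, $v\in V$), the completion time $T_{m,v}$ of the $m$-th service at node $v$ is determined by $$T_{m,v}=S_{m,v}+\max\Big(\{0\}\cup\{T_{m,u}:(u,v)\in E\}\cup\{T_{m-1,v}: m\ge 1\}\cup\{T_{m-b,w}:(v,w)\in E,\ m\ge b\}\Big).$$ The throughput at node $v$ is $\theta_v(N)=\mathbb E\big[(\lim_{m\to\infty}T_{m,v}/m)^{-1}\big]$, and the throughput $\theta(N)$ of $N$ is the common value of the $\theta_v(N)$, $v\in V$. A sequence $\mathcal N=\{N_i\}_{i\ge1}$ of FJQN/Bs is *throughput scalable* if $\liminf_{i\to\infty}\theta(N_i)>0$. **Topological notions.** The degree $D(N)$ is the maximal number of arcs (in and out) at a node. The minimum level is $L^*(N)=\min_l\max_{(u,v)\in E}(l(v)-l(u))$, the minimum being over all $l:V\to\mathbb Z$ with $l(v)-l(u)\ge 1$ for every $(u,v)\in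 E$. The diameter $\Delta(N)$ is that of $G$. The *scaling dimension* $dim_S(\mathcal N)\in[-\infty,\infty]$ is the supremum of $\limsup_{n\to\infty}\log|\bar V_n|/\log\Delta(\bar N_n)$ over all strictly increasing sequences of indices $i_1<i_2<\cdots$ and all connected subnetworks $\bar N_n=(\bar V_n,\bar E_n)$ of $N_{i_n}$ (that is, $\bar V_n\subseteq V_{i_n}$, $\bar E_n\subseteq E_{i_n}$) with $\Delta(\bar N_n)\to\infty$. The *extended metric dimension* $dim_{EM}(\mathcal N)\in\{0,1,2,\dots\}\cup\{\infty\}$ is the least integer $k$ for which there is a constant $\Lambda>0$ such that, for every $i$, there are subsets $W_1,\dots,W_j\subseteq V_i$ with $j\le k$ such that for every $v\in V_i$ at most $\Lambda$ nodes $u\in V_i$ satisfy $dis(u,W_t)=dis(v,W_t)$ for all $t\le j$, where $dis(u,W)$ is the smallest distance in $G_i$ from $u$ to a node of $W$ (and $dim_{EM}(\mathcal N)=\infty$ if there is no such $k$). **Theorem.** Let $\mathcal N=\{N_i\}_{i=1}^\infty$, $N_i=(V_i,E_i)$, be a sequence of FJQN/Bs with $|V_i|<\infty$ for all $i$ and $\limsup_{i\to\infty}|V_i|=\infty$,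 with a common buffer capacity $b$. Suppose that in each network the service times are i.i.d. with a distribution $F_\sigma$ on $[0,\infty)$ that does not depend on $i$ and is regularly varying with index $\alpha>1$, i.e. $\lim_{x\to\infty}\bar F_\sigma(tx)/\bar F_\sigma(x)=t^{-\alpha}$ for all $t>0$, where $\bar F_\sigma=1-F_\sigma$. Suppose also that $$\limsup_{i\to\infty}D(N_i)<\infty\quad\text{and}\quad\limsup_{i\to\infty}L^*(N_i)<\infty .$$ Then the throughput of every $N_i$ is well defined (for every $v\in V_i$ the limit of $T_{m,v}/m$ exists almost surely, $\theta_v(N_i)$ does not depend on $v$, and $\theta(N_i)=\big(\lim_{m\to\infty}\mathbb E[T_{m,v}]/m\big)^{-1}$), and: 1. if $dim_{EM}(\mathcal N)<\alpha-1$, then $\mathcal N$ is throughput scalable; 2. if $\mathcal N$ is throughput scalable, then $dim_S(\mathcal N)\le\alpha-1$. -/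

import Mathlib

open Filter Topology MeasureTheory ProbabilityTheory
open scoped NNReal ENNReal

/-- A fork-join queueing network with node set `V`: a directed acyclic graph whose underlying
undirected graph is connected. (All buffers have a common capacity, supplied separately.) -/
structure ForkJoinNetwork (V : Type*) where
  /-- `Arc u v`: there is an arc from `u` to `v`. -/
  Arc : V → V → Prop
  acyclic : ∀ v, ¬ Relation.TransGen Arc v v
  connected : (SimpleGraph.fromRel Arc).Connected

namespace ForkJoinNetwork

variable {V : Type*}

/-- The undirected counterpart of the network. -/
def graph (N : ForkJoinNetwork V) : SimpleGraph V := SimpleGraph.fromRel N.Arc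

open Classical in
/-- The number of strict ancestors of a node. It serves only as a termination measure. -/
noncomputable def rank [Fintype V] (N : ForkJoinNetwork V) (v : V) : ℕ :=
  (Finset.univ.filter fun u => Relation.TransGen N.Arc u v).card

theorem rank_lt [Fintype V] (N : ForkJoinNetwork V) {u v : V} (h : N.Arc u v) :
    N.rank u < N.rank v := by
  classical
  refine Finset.card_lt_card (Finset.ssubset_iff_of_subset (fun w hw => ?_) |>.2 ⟨u, ?_, ?_⟩)
  · simp only [Finset.mem_filter, Finset.mem_univ, true_and] at hw ⊢
    exact hw.tail h
  · simpa using Relation.TransGen.single h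
  · simpa using N.acyclic u

/-! ### Dynamics -/

open Classical in
/-- The completion time of the `m`-th service (`m = 0, 1, 2, …`) at node `v`, when the service
times are `s` and every buffer has capacity `b` and is empty at time zero. The service starts
as soon as the server is not starved, has finished its previous service, and is not blocked.
Absent constraints contribute `0`, the initial time. -/
noncomputable def completionTime [Fintype V] (N : ForkJoinNetwork V) (b : ℕ+)
    (s : ℕ → V → ℝ≥0) (m : ℕ) (v : V) : ℝ≥0 :=
  s m v +
    max (Finset.univ.sup fun u : V => if _h : N.Arc u v then N.completionTime b s m u else 0)
      (max (if _h : 1 ≤ m then N.completionTime b s (m - 1) v else 0)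
        (Finset.univ.sup fun w : V =>
          if _h : N.Arc v w ∧ (b : ℕ) ≤ m then N.completionTime b s (m - b) w else 0))
termination_by (m, N.rank v)
decreasing_by
  · exact Prod.Lex.right _ (N.rank_lt _h)
  · exact Prod.Lex.left _ _ (by omega)
  · exact Prod.Lex.left _ _ (Nat.sub_lt (lt_of_lt_of_le b.pos _h.2) b.pos)

/-- The throughput at node `v` for random service times `S`: the expectation of the inverse of
the limit of `T m v / m`, where `T m v` is the `m`-th completion time at `v`. The limit is
written as an upper limit in `[0, ∞]`, so that the definition makes sense before it is known
that the limit exists almost surely. -/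
noncomputable def nodeThroughput [Fintype V] {Ω : Type*} [MeasurableSpace Ω] (P : Measure Ω)
    (N : ForkJoinNetwork V) (b : ℕ+) (S : ℕ → V → Ω → ℝ≥0) (v : V) : ℝ≥0∞ :=
  ∫⁻ ω, (limsup (fun m : ℕ =>
    (N.completionTime b (fun k u => S k u ω) m v : ℝ≥0∞) / (m : ℝ≥0∞)) atTop)⁻¹ ∂P

/-- The throughput of the network, i.e. the common value of the throughputs at its nodes. -/
noncomputable def throughput [Fintype V] {Ω : Type*} [MeasurableSpace Ω] (P : Measure Ω)
    (N : ForkJoinNetwork V) (b : ℕ+) (S : ℕ → V → Ω → ℝ≥0) : ℝ≥0∞ :=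
  ⨅ v, N.nodeThroughput P b S v

/-- The throughput of the network is well defined: at every node `v` the limit of `T m v / m`
exists almost surely, the throughput at `v` is that of the network, and it is also the inverse
of the limit of `𝔼[T m v] / m`. -/
def ThroughputWellDefined [Fintype V] {Ω : Type*} [MeasurableSpace Ω] (P : Measure Ω)
    (N : ForkJoinNetwork V) (b : ℕ+) (S : ℕ → V → Ω → ℝ≥0) : Prop :=
  ∀ v : V,
    (∀ᵐ ω ∂P, ∃ l : ℝ≥0, Tendsto (fun m : ℕ =>
      N.completionTime b (fun k u => S k u ω) m v / (m : ℝ≥0)) atTop (𝓝 l)) ∧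
    N.nodeThroughput P b S v = N.throughput P b S ∧
    Tendsto (fun m : ℕ =>
      (∫⁻ ω, (N.completionTime b (fun k u => S k u ω) m v : ℝ≥0∞) ∂P) / (m : ℝ≥0∞)) atTop
      (𝓝 (N.throughput P b S)⁻¹)

/-! ### Topological notions -/

/-- The network degree: the largest number of arcs, in and out, at a node. -/
noncomputable def degree (N : ForkJoinNetwork V) : ℕ∞ :=
  ⨆ v, ({u | N.Arc u v}.encard + {w | N.Arc v w}.encard)

/-- A topological labelling increases by at least one along every arc. -/
def IsTopologicalLabelling (N : ForkJoinNetwork V) (l : V → ℤ) : Prop :=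
  ∀ u v, N.Arc u v → 1 ≤ l v - l u

/-- The minimum level: the least value, over all topological labellings `l`, of the largest
increment of `l` along an arc. -/
noncomputable def minLevel (N : ForkJoinNetwork V) : ℕ∞ :=
  ⨅ (l : V → ℤ) (_ : N.IsTopologicalLabelling l),
    ⨆ (u : V) (v : V) (_ : N.Arc u v), ((l v - l u).toNat : ℕ∞)

/-- The diameter of the network: that of its undirected counterpart. -/
noncomputable def diameter (N : ForkJoinNetwork V) : ℕ := N.graph.diam

/-- A (connected) subnetwork: a network on a subset `W` of the nodes, all of whose arcs are
arcs of `N`. -/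
def IsSubnetwork {W : Set V} (M : ForkJoinNetwork W) (N : ForkJoinNetwork V) : Prop :=
  ∀ u v : W, M.Arc u v → N.Arc u v

/-- The distance in the undirected counterpart from a node to a set of nodes. -/
noncomputable def distSet (N : ForkJoinNetwork V) (v : V) (W : Set V) : ℕ∞ :=
  ⨅ w ∈ W, N.graph.edist v w

/-- The extended metric representation of a node with respect to `k` sets of nodes. -/
noncomputable def extendedRep (N : ForkJoinNetwork V) {k : ℕ} (W : Fin k → Set V) (v : V) :
    Fin k → ℕ∞ :=
  fun t => N.distSet v (W t)

/-- `W` is a `Λ`-extended resolving set: at most `Λ` nodes share a representation. -/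
def IsExtendedResolving (N : ForkJoinNetwork V) (Λ : ℕ) {k : ℕ} (W : Fin k → Set V) : Prop :=
  ∀ v, {u | N.extendedRep W u = N.extendedRep W v}.encard ≤ Λ

end ForkJoinNetwork

/-! ### Sequences of networks -/

/-- The scaling dimension of a sequence of networks: the supremum, over all strictly increasing
sequences of indices and connected subnetworks of the corresponding networks whose diameters
tend to infinity, of the upper limit of (log size) / (log diameter). -/
noncomputable def scalingDim {V : ℕ → Type*} (N : ∀ i, ForkJoinNetwork (V i)) : EReal :=
  sSup {d : EReal | ∃ (idx : ℕ → ℕ) (W : ∀ n, Set (V (idx n)))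
      (M : ∀ n, ForkJoinNetwork (W n)),
    StrictMono idx ∧ (∀ n, (M n).IsSubnetwork (N (idx n))) ∧
    Tendsto (fun n => (M n).diameter) atTop atTop ∧
    d = limsup (fun n =>
      ((Real.log ((W n).ncard : ℝ) / Real.log ((M n).diameter : ℝ) : ℝ) : EReal)) atTop}

/-- The extended metric dimension of a sequence of networks: the least `k` such that, for some
constant `Λ`, every network of the sequence has a `Λ`-extended resolving set of cardinality at
most `k` (and `∞` if there is no such `k`). -/
noncomputable def extendedMetricDim {V : ℕ → Type*} (N : ∀ i, ForkJoinNetwork (V i)) : ℕ∞ :=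
  ⨅ (k : ℕ) (_ : ∃ Λ : ℕ, 0 < Λ ∧ ∀ i, ∃ j ≤ k, ∃ W : Fin j → Set (V i),
    (N i).IsExtendedResolving Λ W), (k : ℕ∞)

/-- The distribution `F` on `[0, ∞)` is regularly varying with index `α`. -/
def IsRegularlyVarying (F : Measure ℝ≥0) (α : ℝ) : Prop :=
  ∀ t : ℝ, 0 < t →
    Tendsto (fun x : ℝ => F.real {y : ℝ≥0 | t * x < y} / F.real {y : ℝ≥0 | x < y}) atTop
      (𝓝 (t ^ (-α)))

/-- A sequence of networks is throughput scalable if the lower limit of the throughputs is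
strictly positive. -/
def ThroughputScalable {V : ℕ → Type*} [∀ i, Fintype (V i)] {Ω : Type*} [MeasurableSpace Ω]
    (P : Measure Ω) (N : ∀ i, ForkJoinNetwork (V i)) (b : ℕ+)
    (S : ∀ i, ℕ → V i → Ω → ℝ≥0) : Prop :=
  0 < liminf (fun i => (N i).throughput P b (S i)) atTop

/-! Well-definedness. Let z(n) be the mean time by which the first n customers have left every node,
and y(n) the mean time by which they have left some node. Restarting the network after a customers
shows that the first time is subadditive (`maxDeparture_add_le`) and the second superadditive
(`minDeparture_add_le`). A delay spreads along one undirected edge within b customers, so z(n) ≤ y(n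
+ bΔ) (`maxDeparture_le_min`). Hence z(n)/n and y(n)/n share a limit γ, and the strong law on
disjoint blocks of n customers squeezes T_m/m onto γ (`exists_timeConstant`). The throughput is 1/γ.

Scalability bounds the scaling dimension. A subnetwork is never slower than the network. In a
subnetwork of diameter D on a node set W, the first D customers receive D|W| services. If D|W| P(S >
x) ≥ 1, one of these exceeds x with probability at least 1/2, and it delays every node within bD
further customers, so γ ≥ x/(4bD) (`throughput_mul_le_of_subnetwork`). If |W| ≥ D^β with β > α - 1,
regular variation allows x of order AD for any fixed A once D is large, so γ is unbounded.

Small metric dimension gives scalability. A completion time is the total service time along a chain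
of services, each waiting for the next (`exists_path_completionTime`). A labelling with increments
at most L makes chains injective, with about (L+1)m members at most. Distances to the resolving
sets, together with the customer index, turn a chain into a path with bounded steps in ℤ^(k+1), with
boundedly many services per point. As for greedy lattice paths, coarse graining into blocks of side
about p^(-1/(k+1)) and an exponential moment bound show that a path of length H meets in expectation
O(H p^(1/(k+1)) + 1) services exceeding a level of tail probability p
(`exists_integrable_ge_path_count`). Summing over the levels 2^j gives a series that converges
because k + 1 < α, and a bound on γ free of the network size (`timeConstant_le`). -/

namespace ForkJoinNetwork

/-! ### Completion times: the recursion, chains, restarts and spreading of delays -/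

section Dynamics

variable {V : Type*} (N : ForkJoinNetwork V) (b : ℕ+) (s : ℕ → V → ℝ≥0)

/-- `Precedes N b x y`: the service `x` is one of those that the service `y` waits for. -/
def Precedes (x y : ℕ × V) : Prop :=
  (N.Arc x.2 y.2 ∧ y.1 = x.1) ∨ (x.2 = y.2 ∧ y.1 = x.1 + 1) ∨ (N.Arc y.2 x.2 ∧ y.1 = x.1 + b)

variable {N b} in
theorem Precedes.fst_le {x y : ℕ × V} (h : N.Precedes b x y) : x.1 ≤ y.1 := by
  rcases h with ⟨-, h⟩ | ⟨-, h⟩ | ⟨-, h⟩ <;> omega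

theorem measurable_univ_sup {ι γ : Type*} [Fintype ι] [MeasurableSpace γ] {f : ι → γ → ℝ≥0}
    (hf : ∀ i, Measurable (f i)) : Measurable fun x => Finset.univ.sup fun i => f i x := by
  have : (fun x => Finset.univ.sup fun i => f i x) = Finset.univ.sup f := by
    ext x
    simp [Finset.sup_apply]
  rw [this]
  rcases (Finset.univ : Finset ι).eq_empty_or_nonempty with h | h
  · rw [h, Finset.sup_empty]
    exact measurable_const
  · rw [← Finset.sup'_eq_sup h]
    exact Finset.measurable_sup' h fun i _ => hf i

variable [Fintype V]

theorem service_le_completionTime (m : ℕ) (v : V) : s m v ≤ N.completionTime b s m v := by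
  rw [completionTime]
  exact le_self_add

theorem add_le_of_arc {u v : V} (h : N.Arc u v) (m : ℕ) :
    s m v + N.completionTime b s m u ≤ N.completionTime b s m v := by
  classical
  rw [completionTime.eq_1 N b s m v]
  gcongr
  refine le_max_of_le_left ?_
  refine le_trans ?_ (Finset.le_sup (Finset.mem_univ u))
  simp [h]

theorem add_le_succ (m : ℕ) (v : V) :
    s (m + 1) v + N.completionTime b s m v ≤ N.completionTime b s (m + 1) v := by
  rw [completionTime.eq_1 N b s (m + 1) v]
  gcongr
  refine le_max_of_le_right (le_max_of_le_left ?_)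
  simp

theorem add_le_of_blocking {v w : V} (h : N.Arc v w) (m : ℕ) :
    s (m + b) v + N.completionTime b s m w ≤ N.completionTime b s (m + b) v := by
  classical
  rw [completionTime.eq_1 N b s (m + b) v]
  gcongr
  refine le_max_of_le_right (le_max_of_le_right ?_)
  refine le_trans ?_ (Finset.le_sup (Finset.mem_univ w))
  simp [h]

theorem completionTime_mono (v : V) : Monotone fun m => N.completionTime b s m v :=
  monotone_nat_of_le_succ fun m => le_trans le_add_self (N.add_le_succ b s m v)

theorem add_le_of_precedes {x y : ℕ × V} (h : N.Precedes b x y) :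
    s y.1 y.2 + N.completionTime b s x.1 x.2 ≤ N.completionTime b s y.1 y.2 := by
  obtain ⟨m, u⟩ := x
  obtain ⟨m', v⟩ := y
  rcases h with ⟨h, rfl⟩ | ⟨rfl, rfl⟩ | ⟨h, rfl⟩
  · exact N.add_le_of_arc b s h _
  · exact N.add_le_succ b s _ _
  · exact N.add_le_of_blocking b s h _

/-- A service starts either at time zero or at the completion of a service it waits for. -/
theorem completionTime_eq_or (m : ℕ) (v : V) :
    N.completionTime b s m v = s m v ∨ ∃ x : ℕ × V, N.Precedes b x (m, v) ∧
      N.completionTime b s m v = s m v + N.completionTime b s x.1 x.2 := by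
  classical
  have hne : (Finset.univ : Finset V).Nonempty := ⟨v, Finset.mem_univ v⟩
  rw [completionTime.eq_1 N b s m v]
  rcases max_choice (Finset.univ.sup fun u : V =>
      if _h : N.Arc u v then N.completionTime b s m u else 0)
      (max (if _h : 1 ≤ m then N.completionTime b s (m - 1) v else 0)
        (Finset.univ.sup fun w : V =>
          if _h : N.Arc v w ∧ (b : ℕ) ≤ m then N.completionTime b s (m - b) w else 0)) with h | h
  · rw [h]
    obtain ⟨u, -, hu⟩ := Finset.exists_mem_eq_sup _ hne fun u : V =>
      if _h : N.Arc u v then N.completionTime b s m u else 0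
    rw [hu]
    by_cases ha : N.Arc u v
    · exact .inr ⟨(m, u), .inl ⟨ha, rfl⟩, by simp [ha]⟩
    · exact .inl (by simp [ha])
  · rw [h]
    rcases max_choice (if _h : 1 ≤ m then N.completionTime b s (m - 1) v else 0)
        (Finset.univ.sup fun w : V =>
          if _h : N.Arc v w ∧ (b : ℕ) ≤ m then N.completionTime b s (m - b) w else 0) with h | h
    · rw [h]
      by_cases hm : 1 ≤ m
      · exact .inr ⟨(m - 1, v), .inr (.inl ⟨rfl, by simp; omega⟩), by simp [hm]⟩
      · exact .inl (by simp [hm])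
    · rw [h]
      obtain ⟨w, -, hw⟩ := Finset.exists_mem_eq_sup _ hne fun w : V =>
        if _h : N.Arc v w ∧ (b : ℕ) ≤ m then N.completionTime b s (m - b) w else 0
      rw [hw]
      by_cases ha : N.Arc v w ∧ (b : ℕ) ≤ m
      · exact .inr ⟨(m - b, w), .inr (.inr ⟨ha.1, by simp; omega⟩), by simp [ha]⟩
      · exact .inl (by simp [ha])

theorem completionTime_le_of {m : ℕ} {v : V} {c : ℝ≥0}
    (h : ∀ x : ℕ × V, N.Precedes b x (m, v) → N.completionTime b s x.1 x.2 ≤ c) :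
    N.completionTime b s m v ≤ s m v + c := by
  rcases N.completionTime_eq_or b s m v with h1 | ⟨x, hx, h1⟩
  · rw [h1]
    exact le_self_add
  · rw [h1]
    gcongr
    exact h x hx

/-- Induction along the order in which completion times are determined. -/
theorem precedes_induction {p : ℕ → V → Prop}
    (ih : ∀ m v, (∀ x : ℕ × V, N.Precedes b x (m, v) → p x.1 x.2) → p m v) (m : ℕ) (v : V) :
    p m v := by
  induction m using Nat.strong_induction_on generalizing v with
  | _ m ihm =>
    induction hr : N.rank v using Nat.strong_induction_on generalizing v with
    | _ r ihr =>
      refine ih m v ?_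
      rintro ⟨m', u⟩ (⟨h, h'⟩ | ⟨h, h'⟩ | ⟨h, h'⟩)
      · obtain rfl : m = m' := h'
        exact ihr _ (hr ▸ N.rank_lt h) u rfl
      · exact ihm _ (by simp at h' ⊢; omega) _
      · have := b.pos
        exact ihm _ (by simp at h' ⊢; omega) _

/-- Completion times depend only on the service times of customers served no later. -/
theorem completionTime_congr {s s' : ℕ → V → ℝ≥0} {m : ℕ} (h : ∀ k ≤ m, s k = s' k) (v : V) :
    N.completionTime b s m v = N.completionTime b s' m v := by
  have key : ∀ (s s' : ℕ → V → ℝ≥0) (m : ℕ) (v : V), (∀ k ≤ m, s k = s' k) →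
      N.completionTime b s m v ≤ N.completionTime b s' m v := by
    intro s s' m v
    refine N.precedes_induction b (p := fun m v => (∀ k ≤ m, s k = s' k) →
      N.completionTime b s m v ≤ N.completionTime b s' m v) ?_ m v
    intro m v ih h
    rcases N.completionTime_eq_or b s m v with h1 | ⟨x, hx, h1⟩
    · rw [h1, h m le_rfl]
      exact N.service_le_completionTime b s' m v
    · rw [h1, h m le_rfl]
      refine le_trans ?_ (N.add_le_of_precedes b s' hx)
      gcongr
      exact ih x hx fun k hk => h k (hk.trans hx.fst_le)
  exact le_antisymm (key s s' m v h) (key s' s m v fun k hk => (h k hk).symm)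

theorem measurable_completionTime (m : ℕ) (v : V) :
    Measurable fun s : ℕ → V → ℝ≥0 => N.completionTime b s m v := by
  classical
  refine N.precedes_induction b (p := fun m v =>
    Measurable fun s : ℕ → V → ℝ≥0 => N.completionTime b s m v) ?_ m v
  intro m v ih
  simp_rw [completionTime.eq_1 N b _ m v]
  refine Measurable.add (by fun_prop) (Measurable.max ?_ (Measurable.max ?_ ?_))
  · refine measurable_univ_sup fun u => ?_
    by_cases h : N.Arc u v
    · simpa [h] using ih (m, u) (.inl ⟨h, rfl⟩)
    · simp [h]
  · by_cases h : 1 ≤ m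
    · simpa [h] using ih (m - 1, v) (.inr (.inl ⟨rfl, by simp; omega⟩))
    · simp [h]
  · refine measurable_univ_sup fun w => ?_
    by_cases h : N.Arc v w ∧ (b : ℕ) ≤ m
    · simpa [h] using ih (m - b, w) (.inr (.inr ⟨h.1, by simp; omega⟩))
    · simp [h]

/-- A completion time is the total service time along a chain of services, each of which waits
for the next one in the chain. -/
theorem exists_path_completionTime (m : ℕ) (v : V) :
    ∃ (n : ℕ) (x : ℕ → ℕ × V), x 0 = (m, v) ∧ (∀ i < n, N.Precedes b (x (i + 1)) (x i)) ∧
      N.completionTime b s m v = ∑ i ∈ Finset.range (n + 1), s (x i).1 (x i).2 := by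
  refine N.precedes_induction b (p := fun m v => ∃ (n : ℕ) (x : ℕ → ℕ × V), x 0 = (m, v) ∧
    (∀ i < n, N.Precedes b (x (i + 1)) (x i)) ∧
      N.completionTime b s m v = ∑ i ∈ Finset.range (n + 1), s (x i).1 (x i).2) ?_ m v
  intro m v ih
  rcases N.completionTime_eq_or b s m v with h1 | ⟨y, hy, h1⟩
  · exact ⟨0, fun _ => (m, v), rfl, by simp, by simpa using h1⟩
  · obtain ⟨n, x, hx0, hx, hsum⟩ := ih y hy
    refine ⟨n + 1, fun i => Nat.casesOn i (m, v) x, rfl, ?_, ?_⟩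
    · rintro (_ | i) hi
      · simpa [hx0] using hy
      · exact hx i (by omega)
    · rw [h1, hsum, add_comm,
        Finset.sum_range_succ' (fun i => s ((fun i => Nat.casesOn i (m, v) x : ℕ → ℕ × V) i).1 _)]
      rfl

theorem completionTime_le_sum (m : ℕ) (v : V) :
    N.completionTime b s m v ≤ ∑ k ∈ Finset.range (m + 1), ∑ u, s k u := by
  classical
  -- For the last customer only `v` and its ancestors are counted: with the full sum the bound would
  -- not reproduce itself along arcs.
  have key : ∀ m : ℕ, ∀ v : V, N.completionTime b s m v ≤
      ∑ k ∈ Finset.range m, ∑ u, s k u +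
        ∑ u ∈ Finset.univ.filter (fun u => u = v ∨ Relation.TransGen N.Arc u v), s m u := by
    refine N.precedes_induction b (p := fun m v => N.completionTime b s m v ≤
      ∑ k ∈ Finset.range m, ∑ u, s k u + ∑ u ∈ Finset.univ.filter
        (fun u => u = v ∨ Relation.TransGen N.Arc u v), s m u) ?_
    intro m v ih
    have hins : ∑ u ∈ Finset.univ.filter (fun u => u = v ∨ Relation.TransGen N.Arc u v), s m u =
        s m v + ∑ u ∈ Finset.univ.filter (fun u => Relation.TransGen N.Arc u v), s m u := by
      rw [← Finset.sum_insert (by simpa using N.acyclic v)]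
      congr 1
      ext u
      simp
    rw [hins, add_left_comm]
    have hfull : ∀ (k : ℕ) (w : V), ∑ u ∈ Finset.univ.filter
        (fun u => u = w ∨ Relation.TransGen N.Arc u w), s k u ≤ ∑ u, s k u := fun k w =>
      Finset.sum_le_sum_of_subset (Finset.filter_subset _ _)
    refine N.completionTime_le_of b s fun x hx => (ih x hx).trans ?_
    obtain ⟨m', w⟩ := x
    have hlt : m' < m → ∑ k ∈ Finset.range m', ∑ u, s k u +
        ∑ u ∈ Finset.univ.filter (fun u => u = w ∨ Relation.TransGen N.Arc u w), s m' u ≤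
        ∑ k ∈ Finset.range m, ∑ u, s k u +
        ∑ u ∈ Finset.univ.filter (fun u => Relation.TransGen N.Arc u v), s m u := by
      intro h
      refine le_trans (add_le_add_right (hfull m' w) _) ?_
      rw [← Finset.sum_range_succ (fun k => ∑ u, s k u)]
      exact le_add_right (Finset.sum_le_sum_of_subset (by simpa using h))
    rcases hx with ⟨h, h'⟩ | ⟨-, h'⟩ | ⟨-, h'⟩
    · obtain rfl : m = m' := h'
      gcongr
      rintro (rfl | h'')
      · exact .single h
      · exact h''.tail h
    · exact hlt (by simp at h'; omega)
    · have := b.pos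
      exact hlt (by simp at h'; omega)
  refine (key m v).trans ?_
  rw [Finset.sum_range_succ]
  exact add_le_add_right (Finset.sum_le_sum_of_subset (Finset.filter_subset _ _)) _

/-- Compare with a fresh network started at time `c`: anything awaited from a customer before `a` is
finished by `c`, so the old customers delay nobody beyond `c`. -/
theorem completionTime_add_le {a : ℕ} {c : ℝ≥0}
    (h : ∀ k < a, ∀ u, N.completionTime b s k u ≤ c) (m : ℕ) (v : V) :
    N.completionTime b s (a + m) v ≤ c + N.completionTime b (fun k => s (a + k)) m v := by
  refine N.precedes_induction b (p := fun m v => N.completionTime b s (a + m) v ≤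
    c + N.completionTime b (fun k => s (a + k)) m v) ?_ m v
  intro m v ih
  rcases N.completionTime_eq_or b s (a + m) v with h1 | ⟨⟨k, w⟩, hx, h1⟩
  · rw [h1]
    exact le_add_left (N.service_le_completionTime b (fun k => s (a + k)) m v)
  · rw [h1]
    rcases lt_or_ge k a with hk | hk
    · rw [add_comm]
      gcongr
      · exact h k hk w
      · exact N.service_le_completionTime b (fun k => s (a + k)) m v
    · obtain ⟨k, rfl⟩ := Nat.exists_eq_add_of_le hk
      have hx' : N.Precedes b (k, w) (m, v) := by
        rcases hx with ⟨h, h'⟩ | ⟨h, h'⟩ | ⟨h, h'⟩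
        · exact .inl ⟨h, by simp at h' ⊢; omega⟩
        · exact .inr (.inl ⟨h, by simp at h' ⊢; omega⟩)
        · exact .inr (.inr ⟨h, by simp at h' ⊢; omega⟩)
      calc s (a + m) v + N.completionTime b s (a + k) w
          ≤ s (a + m) v + (c + N.completionTime b (fun k => s (a + k)) k w) := by
            gcongr
            exact ih (k, w) hx'
        _ = c + (s (a + m) v + N.completionTime b (fun k => s (a + k)) k w) := by ring
        _ ≤ _ := by
            gcongr
            exact N.add_le_of_precedes b (fun k => s (a + k)) hx'

/-- A fresh service that would start at once must here still wait for the previous customer at its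
node, who does not finish before `c`. -/
theorem le_completionTime_add {a : ℕ} {c : ℝ≥0}
    (h : ∀ u, c ≤ N.completionTime b s a u) (m : ℕ) (v : V) :
    c + N.completionTime b (fun k => s (a + 1 + k)) m v ≤ N.completionTime b s (a + 1 + m) v := by
  refine N.precedes_induction b (p := fun m v => c + N.completionTime b (fun k => s (a + 1 + k)) m v
    ≤ N.completionTime b s (a + 1 + m) v) ?_ m v
  intro m v ih
  rcases N.completionTime_eq_or b (fun k => s (a + 1 + k)) m v with h1 | ⟨⟨k, w⟩, hx, h1⟩
  · rw [h1, add_comm]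
    have := N.add_le_succ b s (a + m) v
    rw [add_right_comm] at this
    refine le_trans ?_ this
    gcongr
    exact (h v).trans (N.completionTime_mono b s v (Nat.le_add_right a m))
  · rw [h1, add_left_comm]
    have hx' : N.Precedes b (a + 1 + k, w) (a + 1 + m, v) := by
      rcases hx with ⟨h, h'⟩ | ⟨h, h'⟩ | ⟨h, h'⟩
      · exact .inl ⟨h, by simp at h' ⊢; omega⟩
      · exact .inr (.inl ⟨h, by simp at h' ⊢; omega⟩)
      · exact .inr (.inr ⟨h, by simp at h' ⊢; omega⟩)
    refine le_trans ?_ (N.add_le_of_precedes b s hx')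
    gcongr
    exact ih (k, w) hx

/-- Along an arc a delay reaches the same customer; against an arc it reaches, through blocking, the
customer `b` places later. So each edge costs at most `b` customers. -/
theorem completionTime_le_of_walk {u v : V} (p : N.graph.Walk u v) (m : ℕ) :
    N.completionTime b s m u ≤ N.completionTime b s (m + b * p.length) v := by
  induction p generalizing m with
  | nil => simp
  | @cons u w v h p ih =>
    have h1 : N.completionTime b s m u ≤ N.completionTime b s (m + b) w := by
      rw [graph, SimpleGraph.fromRel_adj] at h
      rcases h.2 with h | h
      · exact (le_trans le_add_self (N.add_le_of_arc b s h m)).trans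
          (N.completionTime_mono b s w (Nat.le_add_right _ _))
      · exact le_trans le_add_self (N.add_le_of_blocking b s h m)
    refine h1.trans ((ih (m + b)).trans (le_of_eq ?_))
    rw [SimpleGraph.Walk.length_cons]
    congr 1
    ring

theorem completionTime_le_of_diameter (u v : V) (m : ℕ) :
    N.completionTime b s m u ≤ N.completionTime b s (m + b * N.diameter) v := by
  have : Nonempty V := ⟨u⟩
  obtain ⟨p, hp⟩ := (show N.graph.Connected from N.connected).exists_walk_length_eq_dist u v
  refine (N.completionTime_le_of_walk b s p m).trans (N.completionTime_mono b s v ?_)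
  have : N.graph.dist u v ≤ N.diameter := by
    refine SimpleGraph.dist_le_diam ?_
    exact SimpleGraph.connected_iff_ediam_ne_top.1 N.connected
  rw [hp]
  gcongr

variable {N} in
/-- Passing to a subnetwork decreases completion times. -/
theorem IsSubnetwork.completionTime_le {W : Set V} [Fintype W] {M : ForkJoinNetwork W}
    (h : M.IsSubnetwork N) (m : ℕ) (v : W) :
    M.completionTime b (fun k u => s k u) m v ≤ N.completionTime b s m v := by
  refine M.precedes_induction b (p := fun m v => M.completionTime b (fun k u => s k u) m v ≤
    N.completionTime b s m v) ?_ m v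
  intro m v ih
  rcases M.completionTime_eq_or b (fun k u => s k u) m v with h1 | ⟨⟨k, w⟩, hx, h1⟩
  · rw [h1]
    exact N.service_le_completionTime b s m v
  · rw [h1]
    have hx' : N.Precedes b (k, (w : V)) (m, (v : V)) := by
      rcases hx with ⟨h', h''⟩ | ⟨h', h''⟩ | ⟨h', h''⟩
      · exact .inl ⟨h _ _ h', h''⟩
      · exact .inr (.inl ⟨congrArg Subtype.val h', h''⟩)
      · exact .inr (.inr ⟨h _ _ h', h''⟩)
    refine le_trans ?_ (N.add_le_of_precedes b s hx')
    gcongr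
    exact ih (k, w) hx

end Dynamics

end ForkJoinNetwork

/-! ### Departure times: subadditivity of the maximum, superadditivity of the minimum -/

namespace ForkJoinNetwork

section Departures

variable {V : Type*} [Fintype V] (N : ForkJoinNetwork V) (b : ℕ+) (s : ℕ → V → ℝ≥0)

/-- The time at which the first `n` customers have left the node `v`. -/
noncomputable def departure (n : ℕ) (v : V) : ℝ≥0 :=
  match n with
  | 0 => 0
  | n + 1 => N.completionTime b s n v

theorem departure_mono (v : V) : Monotone fun n => N.departure b s n v := by
  refine monotone_nat_of_le_succ fun n => ?_
  cases n with
  | zero => exact zero_le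
  | succ n => exact N.completionTime_mono b s v (Nat.le_succ n)

theorem departure_congr {s s' : ℕ → V → ℝ≥0} {n : ℕ} (h : ∀ k < n, s k = s' k) (v : V) :
    N.departure b s n v = N.departure b s' n v := by
  cases n with
  | zero => rfl
  | succ n => exact N.completionTime_congr b (fun k hk => h k (by omega)) v

theorem measurable_departure (n : ℕ) (v : V) :
    Measurable fun s : ℕ → V → ℝ≥0 => N.departure b s n v := by
  cases n with
  | zero => exact measurable_const
  | succ n => exact N.measurable_completionTime b n v

theorem departure_le_sum (n : ℕ) (v : V) :
    N.departure b s n v ≤ ∑ k ∈ Finset.range n, ∑ u, s k u := by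
  cases n with
  | zero => exact zero_le
  | succ n => exact N.completionTime_le_sum b s n v

theorem departure_add_le {a : ℕ} {c : ℝ≥0} (h : ∀ u, N.departure b s a u ≤ c) (n : ℕ) (v : V) :
    N.departure b s (a + n) v ≤ c + N.departure b (fun k => s (a + k)) n v := by
  cases n with
  | zero => exact (h v).trans le_self_add
  | succ n =>
    refine N.completionTime_add_le b s (fun k hk u => ?_) n v
    exact (N.departure_mono b s u (show k + 1 ≤ a by omega)).trans (h u)

theorem le_departure_add {a : ℕ} {c : ℝ≥0} (h : ∀ u, c ≤ N.departure b s a u) (n : ℕ) (v : V) :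
    c + N.departure b (fun k => s (a + k)) n v ≤ N.departure b s (a + n) v := by
  cases n with
  | zero => exact (add_zero c).le.trans (h v)
  | succ n =>
    cases a with
    | zero =>
      obtain rfl : c = 0 := le_antisymm (h v) zero_le
      simp
    | succ a => exact N.le_completionTime_add b s h n v

theorem departure_le_of_diameter (u v : V) (n : ℕ) :
    N.departure b s n u ≤ N.departure b s (n + b * N.diameter) v := by
  cases n with
  | zero => exact zero_le
  | succ n =>
    rw [add_right_comm]
    exact N.completionTime_le_of_diameter b s u v n

theorem univ_nonempty (N : ForkJoinNetwork V) : (Finset.univ : Finset V).Nonempty :=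
  have : Nonempty V := N.connected.nonempty
  Finset.univ_nonempty

/-- The time at which the first `n` customers have left every node. -/
noncomputable def maxDeparture (n : ℕ) : ℝ≥0 := Finset.univ.sup fun v => N.departure b s n v

/-- The time at which the first `n` customers have left some node. -/
noncomputable def minDeparture (n : ℕ) : ℝ≥0 :=
  Finset.univ.inf' N.univ_nonempty fun v => N.departure b s n v

theorem departure_le_max (n : ℕ) (v : V) : N.departure b s n v ≤ N.maxDeparture b s n :=
  Finset.le_sup (f := fun v => N.departure b s n v) (Finset.mem_univ v)

theorem min_le_departure (n : ℕ) (v : V) : N.minDeparture b s n ≤ N.departure b s n v :=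
  Finset.inf'_le _ (Finset.mem_univ v)

theorem maxDeparture_le {n : ℕ} {c : ℝ≥0} (h : ∀ v, N.departure b s n v ≤ c) :
    N.maxDeparture b s n ≤ c :=
  Finset.sup_le fun v _ => h v

theorem le_minDeparture {n : ℕ} {c : ℝ≥0} (h : ∀ v, c ≤ N.departure b s n v) :
    c ≤ N.minDeparture b s n :=
  Finset.le_inf' _ _ fun v _ => h v

theorem maxDeparture_mono : Monotone fun n => N.maxDeparture b s n := fun _ _ h =>
  N.maxDeparture_le b s fun v => (N.departure_mono b s v h).trans (N.departure_le_max b s _ v)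

theorem minDeparture_mono : Monotone fun n => N.minDeparture b s n := fun _ _ h =>
  N.le_minDeparture b s fun v => (N.min_le_departure b s _ v).trans (N.departure_mono b s v h)

theorem maxDeparture_add_le (a n : ℕ) : N.maxDeparture b s (a + n) ≤
    N.maxDeparture b s a + N.maxDeparture b (fun k => s (a + k)) n :=
  N.maxDeparture_le b s fun v =>
    (N.departure_add_le b s (N.departure_le_max b s a) n v).trans
      (add_le_add_right (N.departure_le_max b _ n v) _)

theorem minDeparture_add_le (a n : ℕ) :
    N.minDeparture b s a + N.minDeparture b (fun k => s (a + k)) n ≤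
      N.minDeparture b s (a + n) :=
  N.le_minDeparture b s fun v =>
    (add_le_add_right (N.min_le_departure b _ n v) _).trans
      (N.le_departure_add b s (N.min_le_departure b s a) n v)

/-- The shift does not depend on `n`, so it disappears after division by `n`; this makes the
subadditive and the superadditive rate coincide. -/
theorem maxDeparture_le_min (n : ℕ) :
    N.maxDeparture b s n ≤ N.minDeparture b s (n + b * N.diameter) :=
  N.maxDeparture_le b s fun u => N.le_minDeparture b s fun v =>
    N.departure_le_of_diameter b s u v n

theorem maxDeparture_congr {s s' : ℕ → V → ℝ≥0} {n : ℕ} (h : ∀ k < n, s k = s' k) :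
    N.maxDeparture b s n = N.maxDeparture b s' n := by
  simp only [maxDeparture, N.departure_congr b h]

theorem minDeparture_congr {s s' : ℕ → V → ℝ≥0} {n : ℕ} (h : ∀ k < n, s k = s' k) :
    N.minDeparture b s n = N.minDeparture b s' n := by
  simp only [minDeparture, N.departure_congr b h]

theorem measurable_maxDeparture (n : ℕ) :
    Measurable fun s : ℕ → V → ℝ≥0 => N.maxDeparture b s n :=
  measurable_univ_sup fun v => N.measurable_departure b n v

theorem measurable_minDeparture (n : ℕ) :
    Measurable fun s : ℕ → V → ℝ≥0 => N.minDeparture b s n := by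
  have : (fun s : ℕ → V → ℝ≥0 => N.minDeparture b s n) =
      Finset.univ.inf' N.univ_nonempty fun v s => N.departure b s n v := by
    ext s
    simp [minDeparture, Finset.inf'_apply]
  rw [this]
  exact Finset.inf'_induction _ _ (fun _ h₁ _ h₂ => h₁.inf h₂)
    fun v _ => N.measurable_departure b n v

theorem service_le_maxDeparture {k n : ℕ} (h : k < n) (v : V) :
    s k v ≤ N.maxDeparture b s n :=
  (N.service_le_completionTime b s k v).trans
    ((N.departure_mono b s v (show k + 1 ≤ n by omega)).trans (N.departure_le_max b s n v))

theorem maxDeparture_le_sum (n : ℕ) :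
    N.maxDeparture b s n ≤ ∑ k ∈ Finset.range n, ∑ u, s k u :=
  N.maxDeparture_le b s fun v => N.departure_le_sum b s n v

theorem minDeparture_le_max (n : ℕ) : N.minDeparture b s n ≤ N.maxDeparture b s n :=
  have ⟨v, _⟩ := N.univ_nonempty
  (N.min_le_departure b s n v).trans (N.departure_le_max b s n v)

theorem maxDeparture_mul_le (n k : ℕ) : N.maxDeparture b s (k * n) ≤
    ∑ j ∈ Finset.range k, N.maxDeparture b (fun i => s (j * n + i)) n := by
  induction k with
  | zero => simp [maxDeparture, departure]
  | succ k ih =>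
    rw [Finset.sum_range_succ, Nat.succ_mul]
    exact (N.maxDeparture_add_le b s _ _).trans (add_le_add_left ih _)

theorem le_minDeparture_mul (n k : ℕ) :
    ∑ j ∈ Finset.range k, N.minDeparture b (fun i => s (j * n + i)) n ≤
      N.minDeparture b s (k * n) := by
  induction k with
  | zero => simp
  | succ k ih =>
    rw [Finset.sum_range_succ, Nat.succ_mul]
    exact (add_le_add_left ih _).trans (N.minDeparture_add_le b s _ _)

end Departures

end ForkJoinNetwork

/-! ### Independent services: stationarity and the strong law along blocks -/

/-- Independent service times with common distribution `F`. -/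
structure IIDServices {V Ω : Type*} [MeasurableSpace Ω] (P : Measure Ω) (F : Measure ℝ≥0)
    (S : ℕ → V → Ω → ℝ≥0) : Prop where
  measurable : ∀ m v, Measurable (S m v)
  law : ∀ m v, P.map (S m v) = F
  indep : iIndepFun (fun p : ℕ × V => S p.1 p.2) P

namespace IIDServices

variable {V Ω : Type*} [MeasurableSpace Ω] {P : Measure Ω}
  {F : Measure ℝ≥0} {S : ℕ → V → Ω → ℝ≥0}

theorem precomp {W : Type*} (h : IIDServices P F S) {f : W → V} (hf : f.Injective) :
    IIDServices P F fun m w => S m (f w) where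
  measurable m w := h.measurable m (f w)
  law m w := h.law m (f w)
  indep := h.indep.precomp (g := fun p : ℕ × W => (p.1, f p.2)) fun p q hpq => by
    simp only [Prod.mk.injEq] at hpq
    exact Prod.ext hpq.1 (hf hpq.2)

theorem shift (h : IIDServices P F S) (a : ℕ) : IIDServices P F fun m => S (a + m) where
  measurable m v := h.measurable (a + m) v
  law m v := h.law (a + m) v
  indep := h.indep.precomp (g := fun p : ℕ × V => (a + p.1, p.2)) fun p q hpq => by
    simp only [Prod.mk.injEq, add_right_inj] at hpq
    exact Prod.ext hpq.1 hpq.2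

theorem isProbabilityMeasure [IsProbabilityMeasure P] [Nonempty V] (h : IIDServices P F S) :
    IsProbabilityMeasure F := by
  obtain ⟨v⟩ := ‹Nonempty V›
  rw [← h.law 0 v]
  exact Measure.isProbabilityMeasure_map (h.measurable 0 v).aemeasurable

theorem measurable_process (h : IIDServices P F S) : Measurable fun ω m v => S m v ω :=
  measurable_pi_lambda _ fun m => measurable_pi_lambda _ fun v => h.measurable m v

/-- By independence the law of the whole process is the product of its marginals, all equal to `F`,
and is therefore invariant under shifts of the customer index. -/
theorem identDistrib_shift [IsProbabilityMeasure P] (h : IIDServices P F S) (a : ℕ)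
    {g : (ℕ → V → ℝ≥0) → ℝ}
    (hg : Measurable g) :
    IdentDistrib (fun ω => g fun m v => S (a + m) v ω) (fun ω => g fun m v => S m v ω) P P := by
  have key : ∀ {S : ℕ → V → Ω → ℝ≥0}, IIDServices P F S →
      P.map (fun ω (p : ℕ × V) => S p.1 p.2 ω) =
        Measure.infinitePi fun p : ℕ × V => P.map (S p.1 p.2) := fun h =>
    h.indep.map_fun_eq_infinitePi_map fun p => h.measurable p.1 p.2
  have hid : IdentDistrib (fun ω (p : ℕ × V) => S (a + p.1) p.2 ω)
      (fun ω (p : ℕ × V) => S p.1 p.2 ω) P P := by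
    refine ⟨(measurable_pi_lambda _ fun p => h.measurable _ _).aemeasurable,
      (measurable_pi_lambda _ fun p => h.measurable _ _).aemeasurable, ?_⟩
    rw [key (h.shift a), key h]
    simp only [h.law]
  exact hid.comp (u := fun x : ℕ × V → ℝ≥0 => g fun m v => x (m, v)) (by fun_prop)

theorem pairwise_indepFun_blocks [Fintype V] (h : IIDServices P F S) {g : (ℕ → V → ℝ≥0) → ℝ}
    (hg : Measurable g) {n : ℕ} (hloc : ∀ s s', (∀ k < n, s k = s' k) → g s = g s') :
    Pairwise fun i j => IndepFun (fun ω => g fun m v => S (i * n + m) v ω)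
      (fun ω => g fun m v => S (j * n + m) v ω) P := by
  classical
  intro i j hij
  let A : ℕ → Finset (ℕ × V) := fun i => Finset.Ico (i * n) (i * n + n) ×ˢ Finset.univ
  have hdisj : Disjoint (A i) (A j) := by
    rw [Finset.disjoint_left]
    rintro ⟨m, v⟩ h1 h2
    simp only [A, Finset.mem_product, Finset.mem_Ico, Finset.mem_univ, and_true] at h1 h2
    rcases lt_or_gt_of_ne hij with h' | h'
    · have : (i + 1) * n ≤ j * n := Nat.mul_le_mul_right n h'
      rw [Nat.succ_mul] at this
      omega
    · have : (j + 1) * n ≤ i * n := Nat.mul_le_mul_right n h'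
      rw [Nat.succ_mul] at this
      omega
  -- By `hloc` the functional does not see service times outside its block, so they may be replaced
  -- by 0; it then factors through finitely many variables.
  let G : ∀ i, (A i → ℝ≥0) → ℝ := fun i y =>
    g fun m v => if hm : (i * n + m, v) ∈ A i then y ⟨_, hm⟩ else 0
  have hG : ∀ i, Measurable (G i) := by
    intro i
    refine hg.comp (measurable_pi_lambda _ fun m => measurable_pi_lambda _ fun v => ?_)
    by_cases hm : (i * n + m, v) ∈ A i
    · simpa [hm] using measurable_pi_apply _
    · simp [hm]
  have heq : ∀ i, (fun ω => g fun m v => S (i * n + m) v ω) =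
      G i ∘ fun ω (p : A i) => S p.1.1 p.1.2 ω := by
    intro i
    ext ω
    refine hloc _ _ fun k hk => ?_
    ext v
    simp [A, hk]
  rw [heq i, heq j]
  exact (h.indep.indepFun_finset (A i) (A j) hdisj fun p => h.measurable p.1 p.2).comp (hG i) (hG j)

theorem tendsto_block_average [IsProbabilityMeasure P] [Fintype V] (h : IIDServices P F S)
    {g : (ℕ → V → ℝ≥0) → ℝ}
    (hg : Measurable g) {n : ℕ} (hloc : ∀ s s', (∀ k < n, s k = s' k) → g s = g s')
    (hint : Integrable (fun ω => g fun m v => S m v ω) P) :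
    ∀ᵐ ω ∂P, Tendsto (fun k : ℕ => (∑ j ∈ Finset.range k, g fun m v => S (j * n + m) v ω) / (k : ℝ))
      atTop (𝓝 (∫ ω, g fun m v => S m v ω ∂P)) := by
  have := strong_law_ae_real (fun (j : ℕ) ω => g fun m v => S (j * n + m) v ω)
    ((h.identDistrib_shift (0 * n) hg).symm.integrable_snd hint)
    (h.pairwise_indepFun_blocks hg hloc)
    (fun i => (h.identDistrib_shift (i * n) hg).trans (h.identDistrib_shift (0 * n) hg).symm)
  rwa [(h.identDistrib_shift (0 * n) hg).integral_eq] at this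

end IIDServices

/-! ### Limits along blocks -/

theorem tendsto_natDiv_div {n : ℕ} (hn : 0 < n) :
    Tendsto (fun m : ℕ => ((m / n : ℕ) : ℝ) / m) atTop (𝓝 (1 / n)) := by
  have := (tendsto_nat_floor_mul_div_atTop (R := ℝ) (a := 1 / n) (by positivity)).comp
    tendsto_natCast_atTop_atTop
  refine this.congr fun m => ?_
  simp only [Function.comp]
  rw [one_div_mul_eq_div, Nat.floor_div_eq_div]

theorem tendsto_natDiv_atTop {n : ℕ} (hn : 0 < n) : Tendsto (fun m : ℕ => m / n) atTop atTop :=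
  tendsto_atTop.2 fun k => eventually_atTop.2 ⟨k * n, fun _ hm => (Nat.le_div_iff_mul_le hn).2 hm⟩

theorem tendsto_lower_blocks {n : ℕ} (hn : 0 < n) {A : ℕ → ℝ} {a : ℝ}
    (hA : Tendsto (fun k : ℕ => A k / k) atTop (𝓝 a)) :
    Tendsto (fun m : ℕ => A (m / n) / m) atTop (𝓝 (a / n)) := by
  have h := (hA.comp (tendsto_natDiv_atTop hn)).mul (tendsto_natDiv_div hn)
  rw [mul_one_div] at h
  refine h.congr' ?_
  filter_upwards [eventually_ge_atTop n] with m hm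
  have h1 : ((m / n : ℕ) : ℝ) ≠ 0 := by
    have : 0 < m / n := Nat.div_pos hm hn
    positivity
  simp only [Function.comp]
  field_simp

theorem tendsto_upper_blocks {n : ℕ} (hn : 0 < n) {A : ℕ → ℝ} {a : ℝ}
    (hA : Tendsto (fun k : ℕ => A k / k) atTop (𝓝 a)) :
    Tendsto (fun m : ℕ => A (m / n + 1) / m) atTop (𝓝 (a / n)) := by
  have h := (hA.comp ((tendsto_add_atTop_nat 1).comp (tendsto_natDiv_atTop hn))).mul
    ((tendsto_natDiv_div hn).add tendsto_one_div_atTop_nhds_zero_nat)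
  rw [add_zero, mul_one_div] at h
  refine h.congr fun m => ?_
  have h1 : ((m / n : ℕ) : ℝ) + 1 ≠ 0 := by positivity
  simp only [Function.comp]
  rw [← add_div, div_mul_div_comm, Nat.cast_add_one, mul_comm, mul_div_mul_left _ _ h1]

theorem tendsto_succ_div {t : ℕ → ℝ} {a : ℝ} (h : Tendsto (fun m : ℕ => t m / m) atTop (𝓝 a)) :
    Tendsto (fun m : ℕ => t (m + 1) / m) atTop (𝓝 a) := by
  have h1 : Tendsto (fun m : ℕ => ((m : ℝ) + 1) / m) atTop (𝓝 1) := by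
    have h2 := (tendsto_const_nhds (x := (1 : ℝ))).add tendsto_one_div_atTop_nhds_zero_nat
    rw [add_zero] at h2
    refine h2.congr' ?_
    filter_upwards [eventually_gt_atTop 0] with m hm
    field_simp
  have h3 := (h.comp (tendsto_add_atTop_nat 1)).mul h1
  rw [mul_one] at h3
  refine h3.congr fun m => ?_
  simp only [Function.comp, Nat.cast_add_one]
  rw [div_mul_div_cancel₀ (by positivity)]

/-! ### Existence of the time constant -/

namespace IIDServices

variable {V Ω : Type*} [MeasurableSpace Ω] {P : Measure Ω}
  {F : Measure ℝ≥0} {S : ℕ → V → Ω → ℝ≥0}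

theorem lintegral_comp (h : IIDServices P F S) {f : ℝ≥0 → ℝ≥0∞} (hf : Measurable f) (m : ℕ)
    (v : V) : ∫⁻ ω, f (S m v ω) ∂P = ∫⁻ x, f x ∂F := by
  rw [← h.law m v, lintegral_map hf (h.measurable m v)]

theorem integrable_service (h : IIDServices P F S) (hF : ∫⁻ x : ℝ≥0, (x : ℝ≥0∞) ∂F ≠ ∞) (m : ℕ)
    (v : V) : Integrable (fun ω => (S m v ω : ℝ)) P := by
  refine ⟨((h.measurable m v).coe_nnreal_real).aestronglyMeasurable, ?_⟩
  rw [hasFiniteIntegral_iff_ofReal (ae_of_all _ fun ω => NNReal.coe_nonneg _)]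
  simp only [ENNReal.ofReal_coe_nnreal]
  rw [h.lintegral_comp measurable_coe_nnreal_ennreal]
  exact hF.lt_top

variable [Fintype V] (N : ForkJoinNetwork V) (b : ℕ+)

theorem integrable_of_le_sum (h : IIDServices P F S) (hF : ∫⁻ x : ℝ≥0, (x : ℝ≥0∞) ∂F ≠ ∞) (n : ℕ)
    {g : (ℕ → V → ℝ≥0) → ℝ≥0} (hg : Measurable g)
    (hle : ∀ s, g s ≤ ∑ k ∈ Finset.range n, ∑ u, s k u) :
    Integrable (fun ω => (g fun k u => S k u ω : ℝ)) P := by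
  have hint : Integrable (fun ω => ∑ k ∈ Finset.range n, ∑ u, (S k u ω : ℝ)) P :=
    integrable_finsetSum _ fun k _ => integrable_finsetSum _ fun u _ => h.integrable_service hF k u
  refine hint.mono' (hg.comp h.measurable_process).coe_nnreal_real.aestronglyMeasurable
    (ae_of_all _ fun ω => ?_)
  rw [Real.norm_of_nonneg (NNReal.coe_nonneg _)]
  exact_mod_cast hle _

theorem integrable_maxDeparture (h : IIDServices P F S) (hF : ∫⁻ x : ℝ≥0, (x : ℝ≥0∞) ∂F ≠ ∞)
    (n : ℕ) : Integrable (fun ω => (N.maxDeparture b (fun k u => S k u ω) n : ℝ)) P :=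
  h.integrable_of_le_sum hF n (g := fun s => N.maxDeparture b s n)
    (N.measurable_maxDeparture b n) fun s => N.maxDeparture_le_sum b s n

theorem integrable_minDeparture (h : IIDServices P F S) (hF : ∫⁻ x : ℝ≥0, (x : ℝ≥0∞) ∂F ≠ ∞)
    (n : ℕ) : Integrable (fun ω => (N.minDeparture b (fun k u => S k u ω) n : ℝ)) P :=
  h.integrable_of_le_sum hF n (g := fun s => N.minDeparture b s n)
    (N.measurable_minDeparture b n) fun s =>
      (N.minDeparture_le_max b s n).trans (N.maxDeparture_le_sum b s n)

theorem integrable_departure (h : IIDServices P F S) (hF : ∫⁻ x : ℝ≥0, (x : ℝ≥0∞) ∂F ≠ ∞)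
    (n : ℕ) (v : V) : Integrable (fun ω => (N.departure b (fun k u => S k u ω) n v : ℝ)) P :=
  h.integrable_of_le_sum hF n (g := fun s => N.departure b s n v)
    (N.measurable_departure b n v) fun s => N.departure_le_sum b s n v

theorem subadditive_integral_maxDeparture [IsProbabilityMeasure P] (h : IIDServices P F S)
    (hF : ∫⁻ x : ℝ≥0, (x : ℝ≥0∞) ∂F ≠ ∞) :
    Subadditive fun n => ∫ ω, (N.maxDeparture b (fun k u => S k u ω) n : ℝ) ∂P := by
  intro a n
  beta_reduce
  rw [← (h.identDistrib_shift a (N.measurable_maxDeparture b n).coe_nnreal_real).integral_eq,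
    ← integral_add (h.integrable_maxDeparture N b hF a)
      ((h.shift a).integrable_maxDeparture N b hF n)]
  exact integral_mono (h.integrable_maxDeparture N b hF (a + n))
    ((h.integrable_maxDeparture N b hF a).add ((h.shift a).integrable_maxDeparture N b hF n))
    fun ω => NNReal.coe_le_coe.2 (N.maxDeparture_add_le b (fun k u => S k u ω) a n)

/-- Services complete at a deterministic asymptotic rate, which is the same at all nodes and is
bounded below by the expected time needed for finitely many services. -/
theorem exists_timeConstant [IsProbabilityMeasure P] (h : IIDServices P F S)
    (hF : ∫⁻ x : ℝ≥0, (x : ℝ≥0∞) ∂F ≠ ∞) :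
    ∃ γ : ℝ≥0,
      (∀ v, ∀ᵐ ω ∂P, Tendsto (fun m : ℕ => (N.completionTime b (fun k u => S k u ω) m v : ℝ) / m)
        atTop (𝓝 γ)) ∧
      (∀ v, Tendsto (fun m : ℕ => (∫ ω, (N.completionTime b (fun k u => S k u ω) m v : ℝ) ∂P) / m)
        atTop (𝓝 γ)) ∧
      ∀ n : ℕ, ∫ ω, (N.minDeparture b (fun k u => S k u ω) n : ℝ) ∂P ≤ n * γ := by
  set z : ℕ → ℝ := fun n => ∫ ω, (N.maxDeparture b (fun k u => S k u ω) n : ℝ) ∂P with hz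
  set y : ℕ → ℝ := fun n => ∫ ω, (N.minDeparture b (fun k u => S k u ω) n : ℝ) ∂P with hy
  have hsub : Subadditive z := h.subadditive_integral_maxDeparture N b hF
  have hz0 : ∀ n, 0 ≤ z n := fun n => integral_nonneg fun ω => NNReal.coe_nonneg _
  have hbdd : BddBelow (Set.range fun n => z n / n) :=
    ⟨0, by rintro _ ⟨n, rfl⟩; exact div_nonneg (hz0 n) n.cast_nonneg⟩
  have hzlim := hsub.tendsto_lim hbdd
  have hγ0 : 0 ≤ hsub.lim :=
    ge_of_tendsto' hzlim fun n => div_nonneg (hz0 n) n.cast_nonneg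
  set γ : ℝ≥0 := ⟨hsub.lim, hγ0⟩ with hγ
  change Tendsto (fun n : ℕ => z n / n) atTop (𝓝 (γ : ℝ)) at hzlim
  set c : ℕ := b * N.diameter
  have hzy : ∀ n, z n ≤ y (n + c) := fun n =>
    integral_mono (h.integrable_maxDeparture N b hF n) (h.integrable_minDeparture N b hF _)
      fun ω => NNReal.coe_le_coe.2 (N.maxDeparture_le_min b _ n)
  have hyz : ∀ n, y n ≤ z n := fun n =>
    integral_mono (h.integrable_minDeparture N b hF n) (h.integrable_maxDeparture N b hF _)
      fun ω => NNReal.coe_le_coe.2 (N.minDeparture_le_max b _ n)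
  -- Squeeze z(n) ≤ y(n + c) ≤ z(n + c), divided by n + c.
  have hylim : Tendsto (fun n : ℕ => y n / n) atTop (𝓝 (γ : ℝ)) := by
    refine (tendsto_add_atTop_iff_nat c).1 ?_
    have h1 : Tendsto (fun n : ℕ => z n / n * ((n : ℝ) / (n + c : ℕ))) atTop (𝓝 ((γ : ℝ) * 1)) := by
      refine hzlim.mul ?_
      simpa using tendsto_natCast_div_add_atTop (𝕜 := ℝ) (c : ℝ)
    rw [mul_one] at h1
    refine tendsto_of_tendsto_of_tendsto_of_le_of_le' h1
      (hzlim.comp (tendsto_add_atTop_nat c)) ?_ ?_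
    · filter_upwards [eventually_gt_atTop 0] with n hn
      rw [div_mul_div_cancel₀ (by positivity)]
      exact div_le_div_of_nonneg_right (hzy n) (Nat.cast_nonneg _)
    · exact .of_forall fun n => div_le_div_of_nonneg_right (hyz _) (Nat.cast_nonneg _)
  have hmax : ∀ᵐ ω ∂P, ∀ n : ℕ, Tendsto (fun k : ℕ => (∑ j ∈ Finset.range k,
      (N.maxDeparture b (fun m v => S (j * n + m) v ω) n : ℝ)) / (k : ℝ)) atTop (𝓝 (z n)) :=
    ae_all_iff.2 fun n => h.tendsto_block_average
      (g := fun s => (N.maxDeparture b s n : ℝ)) (N.measurable_maxDeparture b n).coe_nnreal_real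
      (fun s s' hs => by rw [N.maxDeparture_congr b hs]) (h.integrable_maxDeparture N b hF n)
  have hmin : ∀ᵐ ω ∂P, ∀ n : ℕ, Tendsto (fun k : ℕ => (∑ j ∈ Finset.range k,
      (N.minDeparture b (fun m v => S (j * n + m) v ω) n : ℝ)) / (k : ℝ)) atTop (𝓝 (y n)) :=
    ae_all_iff.2 fun n => h.tendsto_block_average
      (g := fun s => (N.minDeparture b s n : ℝ)) (N.measurable_minDeparture b n).coe_nnreal_real
      (fun s s' hs => by rw [N.minDeparture_congr b hs]) (h.integrable_minDeparture N b hF n)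
  have hlow : ∀ s : ℕ → V → ℝ≥0, ∀ n m v, ∑ j ∈ Finset.range (m / n),
      (N.minDeparture b (fun i => s (j * n + i)) n : ℝ) ≤ N.departure b s m v := by
    intro s n m v
    have h1 := (N.le_minDeparture_mul b s n (m / n)).trans
      ((N.minDeparture_mono b s (Nat.div_mul_le_self m n)).trans (N.min_le_departure b s m v))
    exact_mod_cast h1
  have hupp : ∀ s : ℕ → V → ℝ≥0, ∀ n m v, 0 < n → (N.departure b s m v : ℝ) ≤
      ∑ j ∈ Finset.range (m / n + 1), (N.maxDeparture b (fun i => s (j * n + i)) n : ℝ) := by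
    intro s n m v hn
    have h1 := (N.departure_le_max b s m v).trans ((N.maxDeparture_mono b s
      (Nat.lt_div_mul_add hn).le).trans
        ((le_of_eq (by rw [Nat.succ_mul])).trans (N.maxDeparture_mul_le b s n (m / n + 1))))
    exact_mod_cast h1
  have hdep : ∀ v, ∀ᵐ ω ∂P, Tendsto (fun m : ℕ => (N.departure b (fun k u => S k u ω) m v : ℝ) / m)
      atTop (𝓝 (γ : ℝ)) := by
    intro v
    filter_upwards [hmax, hmin] with ω hω1 hω2
    rw [tendsto_order]
    constructor
    -- The block length `n` is fixed first, with y(n)/n already above `a`; only then does the number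
    -- of blocks tend to infinity.
    · intro a ha
      obtain ⟨n, hn1, hn⟩ := ((hylim.eventually (lt_mem_nhds ha)).and (eventually_gt_atTop 0)).exists
      filter_upwards [(tendsto_lower_blocks hn (hω2 n)).eventually (lt_mem_nhds hn1)] with m hm
      refine hm.trans_le (div_le_div_of_nonneg_right ?_ m.cast_nonneg)
      exact hlow (fun k u => S k u ω) n m v
    · intro a ha
      obtain ⟨n, hn1, hn⟩ := ((hzlim.eventually (gt_mem_nhds ha)).and (eventually_gt_atTop 0)).exists
      filter_upwards [(tendsto_upper_blocks hn (hω1 n)).eventually (gt_mem_nhds hn1)] with m hm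
      refine (div_le_div_of_nonneg_right ?_ m.cast_nonneg).trans_lt hm
      exact hupp (fun k u => S k u ω) n m v hn
  refine ⟨γ, fun v => (hdep v).mono fun ω hω => tendsto_succ_div hω, fun v => ?_, fun n => ?_⟩
  · refine tendsto_succ_div
      (t := fun m => ∫ ω, (N.departure b (fun k u => S k u ω) m v : ℝ) ∂P) ?_
    refine tendsto_of_tendsto_of_tendsto_of_le_of_le hylim hzlim
      (fun n => div_le_div_of_nonneg_right ?_ n.cast_nonneg)
      (fun n => div_le_div_of_nonneg_right ?_ n.cast_nonneg)
    · exact integral_mono (h.integrable_minDeparture N b hF n) (h.integrable_departure N b hF n v)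
        fun ω => NNReal.coe_le_coe.2 (N.min_le_departure b _ n v)
    · exact integral_mono (h.integrable_departure N b hF n v) (h.integrable_maxDeparture N b hF n)
        fun ω => NNReal.coe_le_coe.2 (N.departure_le_max b _ n v)
  · obtain ⟨v, -⟩ := N.univ_nonempty
    -- At a single sample point where both limits exist, the lower block averages tend to y(n)/n and
    -- stay below a quantity tending to γ.
    obtain ⟨ω, hω, hω2⟩ := ((hdep v).and hmin).exists
    rcases n.eq_zero_or_pos with rfl | hn
    · obtain ⟨w, hw⟩ := N.univ_nonempty
      have : ∀ s, N.minDeparture b s 0 = 0 := fun s =>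
        le_antisymm (N.min_le_departure b s 0 w) zero_le
      simp [this]
    have := le_of_tendsto_of_tendsto' (tendsto_lower_blocks hn (hω2 n)) hω fun m =>
      div_le_div_of_nonneg_right (hlow (fun k u => S k u ω) n m v) m.cast_nonneg
    rwa [div_le_iff₀' (by positivity)] at this

end IIDServices

/-! ### Regularly varying tails along powers of two -/

/-- Each level 2^j exceeded pays 2^(j+1). The remainder keeps all of `x` rather than its excess: if
2^J < x ≤ 2^(J+1), the payment at level J alone covers `x`. -/
theorem le_one_add_sum_dyadic (x : ℝ) (J : ℕ) :
    x ≤ 1 + ∑ j ∈ Finset.range J, 2 ^ (j + 1) * (Set.Ioi ((2 : ℝ) ^ j)).indicator 1 x +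
      (Set.Ioi ((2 : ℝ) ^ J)).indicator id x := by
  induction J with
  | zero =>
    by_cases h : 1 < x
    · simp [h]
    · simp [h, not_lt.1 h]
  | succ J ih =>
    rw [Finset.sum_range_succ]
    refine ih.trans ?_
    have : (Set.Ioi ((2 : ℝ) ^ J)).indicator id x ≤
        2 ^ (J + 1) * (Set.Ioi ((2 : ℝ) ^ J)).indicator 1 x +
          (Set.Ioi ((2 : ℝ) ^ (J + 1))).indicator id x := by
      by_cases h1 : (2 : ℝ) ^ J < x
      · by_cases h2 : (2 : ℝ) ^ (J + 1) < x
        · simp [h1, h2]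
        · simp [h1, h2, not_lt.1 h2]
      · have h2 : ¬ (2 : ℝ) ^ (J + 1) < x := fun h =>
          h1 (lt_of_le_of_lt (pow_le_pow_right₀ one_le_two (Nat.le_succ J)) h)
        simp [h1, h2]
    linarith

namespace IsRegularlyVarying

variable {F : Measure ℝ≥0} {α : ℝ}

theorem tail_pos [IsFiniteMeasure F] (h : IsRegularlyVarying F α) (x : ℝ) :
    0 < F.real {y : ℝ≥0 | x < y} := by
  have h1 := h 1 one_pos
  simp only [one_mul, Real.one_rpow] at h1
  obtain ⟨z, hz, hzx⟩ := ((h1.eventually (lt_mem_nhds one_half_lt_one)).and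
    (eventually_ge_atTop x)).exists
  have h2 : 0 < F.real {y : ℝ≥0 | z < y} := by
    by_contra hc
    -- A vanishing tail would make the ratio 0/0, which is 0 here, against its limit 1.
    have : F.real {y : ℝ≥0 | z < y} = 0 := le_antisymm (not_lt.1 hc) measureReal_nonneg
    rw [this] at hz
    norm_num at hz
  exact h2.trans_le (measureReal_mono fun y hy => hzx.trans_lt hy)

theorem tendsto_ratio_dyadic (h : IsRegularlyVarying F α) :
    Tendsto (fun j : ℕ => F.real {y : ℝ≥0 | (2 : ℝ) ^ (j + 1) < y} /
      F.real {y : ℝ≥0 | (2 : ℝ) ^ j < y}) atTop (𝓝 (2 ^ (-α))) := by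
  have h1 := (h 2 two_pos).comp (tendsto_pow_atTop_atTop_of_one_lt (one_lt_two (α := ℝ)))
  refine h1.congr fun j => ?_
  simp only [Function.comp, pow_succ']

/-- Consecutive terms have a ratio tending to 2^(1 - α/d) < 1. The case d = 1 gives the finite mean,
the case d = k + 1 the uniform bound on time constants. -/
theorem summable_dyadic [IsFiniteMeasure F] (h : IsRegularlyVarying F α) {d : ℝ} (hd : 0 < d)
    (hdα : d < α) : Summable fun j : ℕ =>
      (2 : ℝ) ^ (j + 1) * F.real {y : ℝ≥0 | (2 : ℝ) ^ j < y} ^ (1 / d) := by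
  have hpos := h.tail_pos
  refine summable_of_ratio_test_tendsto_lt_one (l := 2 * (2 ^ (-α)) ^ (1 / d)) ?_
    (.of_forall fun j => ?_) ?_
  · rw [← Real.rpow_mul two_pos.le]
    nth_rewrite 1 [← Real.rpow_one 2]
    rw [← Real.rpow_add two_pos]
    refine Real.rpow_lt_one_of_one_lt_of_neg one_lt_two ?_
    rw [mul_one_div, neg_div]
    have : 1 < α / d := (one_lt_div hd).2 hdα
    linarith
  · have := Real.rpow_pos_of_pos (hpos (2 ^ j)) (1 / d)
    positivity
  · refine ((h.tendsto_ratio_dyadic.rpow_const (p := 1 / d)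
      (.inl (by positivity))).const_mul 2).congr fun j => ?_
    have h1 := Real.rpow_pos_of_pos (hpos (2 ^ j)) (1 / d)
    have h2 := Real.rpow_pos_of_pos (hpos (2 ^ (j + 1))) (1 / d)
    rw [Real.norm_of_nonneg (by positivity), Real.norm_of_nonneg (by positivity),
      Real.div_rpow (hpos _).le (hpos _).le, pow_succ _ (j + 1)]
    field_simp

/-- The reciprocals pass the ratio test with limit 2^(α - β) < 1, so they tend to 0 through positive
values. -/
theorem tendsto_dyadic_atTop [IsFiniteMeasure F] (h : IsRegularlyVarying F α) {β : ℝ}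
    (hβ : α < β) : Tendsto (fun j : ℕ =>
      ((2 : ℝ) ^ j) ^ β * F.real {y : ℝ≥0 | (2 : ℝ) ^ j < y}) atTop atTop := by
  have hpos := h.tail_pos
  have hfpos : ∀ j : ℕ, 0 < ((2 : ℝ) ^ j) ^ β * F.real {y : ℝ≥0 | (2 : ℝ) ^ j < y} := fun j =>
    mul_pos (by positivity) (hpos _)
  have hsum : Summable fun j : ℕ =>
      (((2 : ℝ) ^ j) ^ β * F.real {y : ℝ≥0 | (2 : ℝ) ^ j < y})⁻¹ := by
    refine summable_of_ratio_test_tendsto_lt_one (l := ((2 : ℝ) ^ β * 2 ^ (-α))⁻¹) ?_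
      (.of_forall fun j => (inv_pos.2 (hfpos j)).ne') ?_
    · rw [← Real.rpow_add two_pos]
      exact inv_lt_one_of_one_lt₀ (Real.one_lt_rpow one_lt_two (by linarith))
    · refine ((h.tendsto_ratio_dyadic.const_mul ((2 : ℝ) ^ β)).inv₀ (by positivity)).congr
        fun j => ?_
      rw [Real.norm_of_nonneg (inv_pos.2 (hfpos _)).le,
        Real.norm_of_nonneg (inv_pos.2 (hfpos _)).le, pow_succ,
        Real.mul_rpow (by positivity) (by positivity)]
      have h1 := hpos (2 ^ j)
      have h2 := hpos (2 ^ j * 2)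
      have h3 : (0 : ℝ) < ((2 : ℝ) ^ j) ^ β := by positivity
      field_simp
  have := hsum.tendsto_atTop_zero
  have h2 : Tendsto (fun j : ℕ => (((2 : ℝ) ^ j) ^ β * F.real {y : ℝ≥0 | (2 : ℝ) ^ j < y})⁻¹) atTop
      (𝓝[>] 0) := tendsto_nhdsWithin_iff.2 ⟨this, .of_forall fun j => inv_pos.2 (hfpos j)⟩
  exact h2.inv_tendsto_nhdsGT_zero.congr fun j => inv_inv _

theorem measurableSet_tail (x : ℝ) : MeasurableSet {y : ℝ≥0 | x < y} :=
  measurableSet_lt measurable_const measurable_coe_nnreal_real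

theorem lintegral_ne_top [IsProbabilityMeasure F] (h : IsRegularlyVarying F α) (hα : 1 < α) :
    ∫⁻ x : ℝ≥0, (x : ℝ≥0∞) ∂F ≠ ∞ := by
  have hsum := h.summable_dyadic one_pos hα
  simp only [div_one, Real.rpow_one] at hsum
  have hle : ∀ x : ℝ≥0, (x : ℝ≥0∞) ≤ 1 + ∑' j : ℕ,
      {y : ℝ≥0 | (2 : ℝ) ^ j < y}.indicator (fun _ => (2 : ℝ≥0∞) ^ (j + 1)) x := by
    intro x
    obtain ⟨J, hJ⟩ := pow_unbounded_of_one_lt (x : ℝ) one_lt_two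
    have h1 := le_one_add_sum_dyadic x J
    rw [Set.indicator_of_notMem (by simpa using hJ.le), add_zero] at h1
    rw [← ENNReal.ofReal_coe_nnreal]
    refine (ENNReal.ofReal_le_ofReal h1).trans ?_
    have h0 : ∀ j ∈ Finset.range J,
        0 ≤ 2 ^ (j + 1) * (Set.Ioi ((2 : ℝ) ^ j)).indicator (1 : ℝ → ℝ) x := fun j _ =>
      mul_nonneg (by positivity) (Set.indicator_nonneg (fun _ _ => zero_le_one) _)
    rw [ENNReal.ofReal_add zero_le_one (Finset.sum_nonneg h0), ENNReal.ofReal_one]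
    gcongr
    rw [ENNReal.ofReal_sum_of_nonneg h0]
    refine le_trans (Finset.sum_le_sum fun j _ => ?_) (ENNReal.sum_le_tsum (Finset.range J))
    by_cases hj : (2 : ℝ) ^ j < x
    · simp [hj, ENNReal.ofReal_pow]
    · simp [hj]
  refine ne_top_of_le_ne_top ?_ (lintegral_mono hle)
  rw [lintegral_add_left measurable_const, lintegral_tsum fun j =>
    (measurable_const.indicator (measurableSet_tail _)).aemeasurable]
  simp only [lintegral_const, measure_univ, mul_one,
    lintegral_indicator_const (measurableSet_tail _)]
  refine ENNReal.add_ne_top.2 ⟨ENNReal.one_ne_top, ?_⟩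
  refine ne_of_eq_of_ne (tsum_congr fun j => ?_) hsum.tsum_ofReal_ne_top
  rw [ENNReal.ofReal_mul (by positivity), ofReal_measureReal, ENNReal.ofReal_pow (by norm_num)]
  simp

end IsRegularlyVarying

/-! ### The throughput as the inverse of the time constant -/

namespace IIDServices

variable {V Ω : Type*} [MeasurableSpace Ω] {P : Measure Ω}
  {F : Measure ℝ≥0} {S : ℕ → V → Ω → ℝ≥0} [Fintype V]

theorem integrable_completionTime (N : ForkJoinNetwork V) (b : ℕ+) (h : IIDServices P F S)
    (hF : ∫⁻ x : ℝ≥0, (x : ℝ≥0∞) ∂F ≠ ∞) (m : ℕ) (v : V) :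
    Integrable (fun ω => (N.completionTime b (fun k u => S k u ω) m v : ℝ)) P :=
  h.integrable_departure N b hF (m + 1) v

/-- The throughput is well defined, and is the inverse of the time constant. -/
theorem exists_throughput_eq [IsProbabilityMeasure P] (N : ForkJoinNetwork V) (b : ℕ+)
    (h : IIDServices P F S)
    (hF : ∫⁻ x : ℝ≥0, (x : ℝ≥0∞) ∂F ≠ ∞) :
    N.ThroughputWellDefined P b S ∧ ∃ γ : ℝ≥0, N.throughput P b S = (γ : ℝ≥0∞)⁻¹ ∧
      (∀ v, Tendsto (fun m : ℕ => (∫ ω, (N.completionTime b (fun k u => S k u ω) m v : ℝ) ∂P) / m)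
        atTop (𝓝 γ)) ∧
      ∀ n : ℕ, ∫ ω, (N.minDeparture b (fun k u => S k u ω) n : ℝ) ∂P ≤ n * γ := by
  obtain ⟨γ, hae, hint, hmin⟩ := h.exists_timeConstant N b hF
  have hnn : ∀ v, ∀ᵐ ω ∂P, Tendsto (fun m : ℕ =>
      N.completionTime b (fun k u => S k u ω) m v / (m : ℝ≥0)) atTop (𝓝 γ) := fun v =>
    (hae v).mono fun ω hω => by
      rw [← NNReal.tendsto_coe]
      simpa using hω
  have hnode : ∀ v, N.nodeThroughput P b S v = (γ : ℝ≥0∞)⁻¹ := by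
    intro v
    rw [ForkJoinNetwork.nodeThroughput]
    have : ∀ᵐ ω ∂P, (limsup (fun m : ℕ =>
        (N.completionTime b (fun k u => S k u ω) m v : ℝ≥0∞) / (m : ℝ≥0∞)) atTop)⁻¹ =
        (γ : ℝ≥0∞)⁻¹ := by
      filter_upwards [hnn v] with ω hω
      congr 1
      refine Tendsto.limsup_eq ((ENNReal.tendsto_coe.2 hω).congr' ?_)
      filter_upwards [eventually_gt_atTop 0] with m hm
      rw [ENNReal.coe_div (by positivity), ENNReal.coe_natCast]
    rw [lintegral_congr_ae this]
    simp
  have : Nonempty V := N.connected.nonempty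
  have hthr : N.throughput P b S = (γ : ℝ≥0∞)⁻¹ := by
    rw [ForkJoinNetwork.throughput]
    simp only [hnode, ciInf_const]
  refine ⟨fun v => ⟨(hnn v).mono fun ω hω => ⟨γ, hω⟩, by rw [hnode, hthr], ?_⟩,
    γ, hthr, hint, hmin⟩
  rw [hthr, inv_inv, ← ENNReal.ofReal_coe_nnreal]
  refine ((ENNReal.continuous_ofReal.tendsto _).comp (hint v)).congr' ?_
  filter_upwards [eventually_gt_atTop 0] with m hm
  simp only [Function.comp]
  rw [ENNReal.ofReal_div_of_pos (by positivity), ENNReal.ofReal_natCast,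
    ofReal_integral_eq_lintegral_ofReal (h.integrable_completionTime N b hF m v)
      (ae_of_all _ fun ω => NNReal.coe_nonneg _)]
  simp only [ENNReal.ofReal_coe_nnreal]

end IIDServices

/-! ### Large subnetworks force a small throughput -/

namespace IIDServices

variable {V Ω : Type*} [MeasurableSpace Ω] {P : Measure Ω}
  {F : Measure ℝ≥0} {S : ℕ → V → Ω → ℝ≥0}

theorem measureReal_tail (h : IIDServices P F S) (m : ℕ) (v : V) (x : ℝ) :
    P.real {ω | x < S m v ω} = F.real {y : ℝ≥0 | x < y} := by
  rw [← h.law m v, map_measureReal_apply (h.measurable m v)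
    (IsRegularlyVarying.measurableSet_tail x)]
  rfl

variable [IsProbabilityMeasure P] [Fintype V]

/-- Among sufficiently many services there probably is a long one. -/
theorem half_le_measureReal_exists (h : IIDServices P F S) (Q : ℕ) (x : ℝ)
    (hQ : 1 ≤ F.real {y : ℝ≥0 | x < y} * (Q * Fintype.card V)) :
    1 / 2 ≤ P.real {ω | ∃ k < Q, ∃ v, x < S k v ω} := by
  set A : Finset (ℕ × V) := Finset.range Q ×ˢ Finset.univ
  have hcompl : {ω | ∃ k < Q, ∃ v, x < S k v ω}ᶜ =
      ⋂ p ∈ A, (fun ω => S p.1 p.2 ω) ⁻¹' {y : ℝ≥0 | x < y}ᶜ := by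
    ext ω
    simp only [A, Set.mem_compl_iff, Set.mem_ofPred_eq, Set.mem_iInter, Set.mem_preimage,
      Finset.mem_product, Finset.mem_range, Finset.mem_univ, and_true, not_exists, not_and,
      Prod.forall]
    exact ⟨fun h k v hk => h k hk v, fun h k hk v => h k v hk⟩
  have hmeas : MeasurableSet {ω | ∃ k < Q, ∃ v, x < S k v ω} := by
    rw [← MeasurableSet.compl_iff, hcompl]
    exact A.measurableSet_biInter fun p _ =>
      h.measurable p.1 p.2 (IsRegularlyVarying.measurableSet_tail x).compl
  have hprod : P.real {ω | ∃ k < Q, ∃ v, x < S k v ω}ᶜ =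
      ∏ p ∈ A, (1 - F.real {y : ℝ≥0 | x < y}) := by
    rw [hcompl, measureReal_def, (iIndepFun_iff_measure_inter_preimage_eq_mul.1 h.indep) A
      (fun _ _ => (IsRegularlyVarying.measurableSet_tail x).compl), ENNReal.toReal_prod]
    refine Finset.prod_congr rfl fun p _ => ?_
    rw [Set.preimage_compl, ← measureReal_def, probReal_compl_eq_one_sub
      (h.measurable p.1 p.2 (IsRegularlyVarying.measurableSet_tail x)), ← h.measureReal_tail p.1 p.2]
    rfl
  rw [Finset.prod_const, probReal_compl_eq_one_sub hmeas] at hprod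
  have hcard : (A.card : ℝ) = Q * Fintype.card V := by simp [A]
  -- The probability that no service is long is (1 - p)^|A| ≤ exp(-p|A|) ≤ 1/e < 1/2.
  have h1 : (1 - F.real {y : ℝ≥0 | x < y}) ^ A.card ≤ Real.exp (-1) := by
    rcases A.card.eq_zero_or_pos with h0 | hpos
    · rw [← hcard, h0] at hQ
      norm_num at hQ
    have hp0 : 0 ≤ 1 - F.real {y : ℝ≥0 | x < y} := by
      obtain ⟨p, -⟩ := Finset.card_pos.1 hpos
      rw [← h.measureReal_tail p.1 p.2, sub_nonneg]
      exact measureReal_le_one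
    calc (1 - F.real {y : ℝ≥0 | x < y}) ^ A.card
        ≤ Real.exp (-F.real {y : ℝ≥0 | x < y}) ^ A.card :=
          pow_le_pow_left₀ hp0 (Real.one_sub_le_exp_neg _) _
      _ = Real.exp (-(F.real {y : ℝ≥0 | x < y} * (Q * Fintype.card V))) := by
          rw [← Real.exp_nat_mul, hcard]
          ring_nf
      _ ≤ Real.exp (-1) := Real.exp_le_exp.2 (neg_le_neg hQ)
  have h2 : Real.exp (-1) < 1 / 2 := Real.exp_neg_one_lt_half
  linarith

/-- Markov's inequality handles the time at which `Q` customers have left every node; `b` times the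
diameter further customers carry this delay to all nodes. -/
theorem half_le_integral_minDeparture (h : IIDServices P F S)
    (hF : ∫⁻ x : ℝ≥0, (x : ℝ≥0∞) ∂F ≠ ∞) (N : ForkJoinNetwork V) (b : ℕ+) (Q : ℕ) {x : ℝ}
    (hx : 0 ≤ x) (hQ : 1 ≤ F.real {y : ℝ≥0 | x < y} * (Q * Fintype.card V)) :
    x / 2 ≤ ∫ ω, (N.minDeparture b (fun k u => S k u ω) (Q + b * N.diameter) : ℝ) ∂P := by
  have h1 := h.half_le_measureReal_exists Q x hQ
  have hmk : x * P.real {ω | x ≤ (N.maxDeparture b (fun k u => S k u ω) Q : ℝ)} ≤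
      ∫ ω, (N.maxDeparture b (fun k u => S k u ω) Q : ℝ) ∂P :=
    mul_meas_ge_le_integral_of_nonneg (ae_of_all _ fun ω => NNReal.coe_nonneg _)
      (h.integrable_maxDeparture N b hF Q) x
  have hsub : P.real {ω | ∃ k < Q, ∃ v, x < S k v ω} ≤
      P.real {ω | x ≤ (N.maxDeparture b (fun k u => S k u ω) Q : ℝ)} := by
    refine measureReal_mono ?_
    rintro ω ⟨k, hk, v, hv⟩
    exact hv.le.trans (NNReal.coe_le_coe.2 (N.service_le_maxDeparture b (fun k u => S k u ω) hk v))
  calc x / 2 = x * (1 / 2) := by ring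
    _ ≤ _ := mul_le_mul_of_nonneg_left (h1.trans hsub) hx
    _ ≤ _ := hmk
    _ ≤ _ := integral_mono (h.integrable_maxDeparture N b hF Q)
      (h.integrable_minDeparture N b hF _)
      fun ω => NNReal.coe_le_coe.2 (N.maxDeparture_le_min b _ Q)

/-- A large subnetwork slows down a network. -/
theorem throughput_mul_le_of_subnetwork (h : IIDServices P F S)
    (hF : ∫⁻ x : ℝ≥0, (x : ℝ≥0∞) ∂F ≠ ∞) (N : ForkJoinNetwork V) (b : ℕ+) {W : Set V}
    {M : ForkJoinNetwork W} (hM : M.IsSubnetwork N) {x : ℝ} (hx : 0 ≤ x)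
    (hQ : 1 ≤ F.real {y : ℝ≥0 | x < y} * (M.diameter * W.ncard)) :
    x ≤ 4 * b * M.diameter * (N.throughput P b S)⁻¹.toReal := by
  classical
  have : Fintype W := Fintype.ofFinite W
  have hW := h.precomp (f := ((↑) : W → V)) Subtype.val_injective
  obtain ⟨-, γ, hγ, hint, -⟩ := h.exists_throughput_eq N b hF
  obtain ⟨-, γ', -, hint', hmin⟩ := hW.exists_throughput_eq M b hF
  have hle : (γ' : ℝ) ≤ γ := by
    obtain ⟨w, -⟩ := M.univ_nonempty
    refine le_of_tendsto_of_tendsto' (hint' w) (hint w) fun m =>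
      div_le_div_of_nonneg_right ?_ m.cast_nonneg
    exact integral_mono (hW.integrable_completionTime M b hF m w)
      (h.integrable_completionTime N b hF m w)
      fun ω => NNReal.coe_le_coe.2 (hM.completionTime_le b (fun k u => S k u ω) m w)
  have h1 := hW.half_le_integral_minDeparture hF M b M.diameter hx
    (by rwa [← Nat.card_eq_fintype_card, Nat.card_coe_set_eq])
  have h2 := h1.trans (hmin _)
  rw [hγ, inv_inv, ENNReal.coe_toReal]
  have hb : (1 : ℝ) ≤ b := by exact_mod_cast b.pos
  -- Taking as many customers as the diameter balances both contributions; D + bD ≤ 2bD since b ≥ 1.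
  have h3 : ((M.diameter + b * M.diameter : ℕ) : ℝ) * γ' ≤ (2 * b * M.diameter) * γ := by
    refine mul_le_mul ?_ hle γ'.coe_nonneg (by positivity)
    push_cast
    nlinarith [(Nat.cast_nonneg M.diameter : (0 : ℝ) ≤ M.diameter)]
  linarith

end IIDServices

theorem scalingDim_le_of_throughputScalable {Ω : Type*} [MeasurableSpace Ω] (P : Measure Ω)
    [IsProbabilityMeasure P] {V : ℕ → Type*} [∀ i, Fintype (V i)] (N : ∀ i, ForkJoinNetwork (V i))
    (b : ℕ+) {F : Measure ℝ≥0} [IsProbabilityMeasure F] {α : ℝ} (hα : 1 < α)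
    (hF : IsRegularlyVarying F α) {S : ∀ i, ℕ → V i → Ω → ℝ≥0}
    (hS : ∀ i, IIDServices P F (S i)) (h : ThroughputScalable P N b S) :
    scalingDim N ≤ ((α - 1 : ℝ) : EReal) := by
  have hmean := hF.lintegral_ne_top hα
  obtain ⟨c, hc0, hc⟩ := exists_between h
  have hthr := eventually_lt_of_lt_liminf hc
  -- Where the throughput exceeds `c`, a service of length at least AD, likely in a subnetwork of
  -- diameter D, would force A ≤ 4b/c; this choice excludes it.
  obtain ⟨A, hA⟩ := exists_nat_gt (4 * b * c⁻¹.toReal)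
  have hA0 : 0 < A := by
    have : (0 : ℝ) < A := lt_of_le_of_lt (by positivity) hA
    exact_mod_cast this
  refine sSup_le ?_
  rintro d ⟨idx, W, M, hidx, hM, hdiam, rfl⟩
  by_contra hd
  obtain ⟨β, hβ1, hβ2⟩ := EReal.lt_iff_exists_real_btwn.1 (not_le.1 hd)
  rw [EReal.coe_lt_coe_iff] at hβ1
  have hβ : α < β + 1 := by linarith
  have hfreq := frequently_lt_of_lt_limsup (by isBoundedDefault) hβ2
  have hAD : Tendsto (fun n => A * (M n).diameter) atTop atTop :=
    tendsto_atTop_mono (fun n => Nat.le_mul_of_pos_left _ hA0) hdiam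
  have hclog : Tendsto (fun n => Nat.clog 2 (A * (M n).diameter)) atTop atTop := by
    refine tendsto_atTop.2 fun k => ?_
    filter_upwards [hAD.eventually_ge_atTop (2 ^ k)] with n hn
    exact (Nat.pow_le_pow_iff_right one_lt_two).1 (hn.trans (Nat.le_pow_clog one_lt_two _))
  -- The level is the least power of two above AD, hence at most 2AD. The threshold (2A)^(β+1)
  -- absorbs this factor, so that P(S > 2^j) times D^(β+1) is at least 1.
  have htail := ((hF.tendsto_dyadic_atTop hβ).comp hclog).eventually_ge_atTop
    (((2 * A : ℕ) : ℝ) ^ (β + 1))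
  obtain ⟨n, hn, hn1, hn2, hn3⟩ := (hfreq.and_eventually (htail.and
    ((hdiam.eventually_ge_atTop 2).and (hidx.tendsto_atTop.eventually hthr)))).exists
  set D := (M n).diameter with hD
  set j := Nat.clog 2 (A * D) with hj
  have hjle : A * D ≤ 2 ^ j := Nat.le_pow_clog one_lt_two _
  have hjlt : 2 ^ j ≤ 2 * A * D := by
    have hAD2 : 1 < A * D := lt_of_lt_of_le (by omega) (Nat.le_mul_of_pos_left D hA0)
    have h1 := Nat.pow_pred_clog_lt_self one_lt_two hAD2
    have h2 : 0 < j := Nat.clog_pos one_lt_two hAD2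
    obtain ⟨i, hi⟩ := Nat.exists_eq_succ_of_ne_zero h2.ne'
    rw [← hj, hi, Nat.pred_succ] at h1
    rw [hi, pow_succ]
    nlinarith
  have hDpos : (0 : ℝ) < D := by
    have : 0 < D := by omega
    exact_mod_cast this
  have hcard : (D : ℝ) ^ β ≤ (W n).ncard := by
    have : Nonempty (W n) := (M n).connected.nonempty
    have hW0 : (0 : ℝ) < (W n).ncard := by
      have : 0 < (W n).ncard := (Set.ncard_pos (Set.toFinite _)).2 (Set.nonempty_coe_sort.1 this)
      exact_mod_cast this
    have hlog : 0 < Real.log D := Real.log_pos (by exact_mod_cast hn2)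
    rw [EReal.coe_lt_coe_iff, lt_div_iff₀ hlog] at hn
    rw [Real.rpow_def_of_pos hDpos, mul_comm, ← Real.le_log_iff_exp_le hW0]
    exact hn.le
  have hp : 1 ≤ F.real {y : ℝ≥0 | (2 : ℝ) ^ j < y} * (D * (W n).ncard) := by
    have hjR : (2 : ℝ) ^ j ≤ ((2 * A : ℕ) : ℝ) * D := by exact_mod_cast hjlt
    have hApos : (0 : ℝ) < ((2 * A : ℕ) : ℝ) ^ (β + 1) := by positivity
    have hp0 := hF.tail_pos (2 ^ j)
    have h2 : ((2 : ℝ) ^ j) ^ (β + 1) ≤ ((2 * A : ℕ) : ℝ) ^ (β + 1) * (D : ℝ) ^ (β + 1) := by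
      rw [← Real.mul_rpow (by positivity) hDpos.le]
      exact Real.rpow_le_rpow (by positivity) hjR (by linarith)
    have h3 : (D : ℝ) ^ (β + 1) ≤ D * (W n).ncard := by
      rw [Real.rpow_add hDpos, Real.rpow_one, mul_comm]
      gcongr
    have h4 : ((2 * A : ℕ) : ℝ) ^ (β + 1) ≤
        ((2 : ℝ) ^ j) ^ (β + 1) * F.real {y : ℝ≥0 | (2 : ℝ) ^ j < y} := hn1
    have h5 : ((2 * A : ℕ) : ℝ) ^ (β + 1) * 1 ≤ ((2 * A : ℕ) : ℝ) ^ (β + 1) *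
        (F.real {y : ℝ≥0 | (2 : ℝ) ^ j < y} * (D * (W n).ncard)) := by
      calc ((2 * A : ℕ) : ℝ) ^ (β + 1) * 1
          ≤ ((2 : ℝ) ^ j) ^ (β + 1) * F.real {y : ℝ≥0 | (2 : ℝ) ^ j < y} := by rwa [mul_one]
        _ ≤ (((2 * A : ℕ) : ℝ) ^ (β + 1) * (D * (W n).ncard)) *
            F.real {y : ℝ≥0 | (2 : ℝ) ^ j < y} := by
          refine mul_le_mul_of_nonneg_right (h2.trans ?_) hp0.le
          gcongr
        _ = _ := by ring
    exact le_of_mul_le_mul_left h5 hApos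
  have hmain := (hS (idx n)).throughput_mul_le_of_subnetwork hmean (N (idx n)) b (hM n)
    (by positivity) hp
  have hγ : ((N (idx n)).throughput P b (S (idx n)))⁻¹.toReal ≤ c⁻¹.toReal :=
    ENNReal.toReal_mono (ENNReal.inv_ne_top.2 hc0.ne') (ENNReal.inv_le_inv.2 hn3.le)
  have h6 : (A : ℝ) * D ≤ 2 ^ j := by exact_mod_cast hjle
  have h7 : (A : ℝ) * D ≤ (4 * b * c⁻¹.toReal) * D := by
    calc (A : ℝ) * D ≤ 4 * b * D * ((N (idx n)).throughput P b (S (idx n)))⁻¹.toReal := h6.trans hmain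
      _ ≤ 4 * b * D * c⁻¹.toReal := by gcongr
      _ = _ := by ring
  exact absurd (le_of_mul_le_mul_right h7 hDpos) (not_le.2 hA)

/-! ### Coarse graining of paths -/

section CoarseGraining

variable {X ι : Type*} [Fintype ι] [DecidableEq ι]

/-- The vectors all of whose coordinates are at most `K` in absolute value. -/
noncomputable def blockSteps (ι : Type*) [Fintype ι] [DecidableEq ι] (K : ℕ) : Finset (ι → ℤ) :=
  Fintype.piFinset fun _ => Finset.Icc (-(K : ℤ)) K

theorem card_blockSteps (K : ℕ) : (blockSteps ι K).card = (2 * K + 1) ^ Fintype.card ι := by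
  rw [blockSteps, Fintype.card_piFinset, Finset.prod_const, Finset.card_univ, Int.card_Icc]
  congr 1
  omega

variable [DecidableEq X]

/-- The points whose blocks of side `ℓ` have coordinates within `K` of `y`, where `fib z` contains
the points at position `z`. -/
noncomputable def blockNeighbourhood (fib : (ι → ℤ) → Finset X) (K ℓ : ℕ) (y : ι → ℤ) : Finset X :=
  (Fintype.piFinset fun t => Finset.Ico ((y t - K) * ℓ) ((y t + K + 1) * ℓ)).biUnion fib

/-- The unions of the neighbourhoods of `n` successive blocks, the first of which is `y`, where
successive blocks have coordinates within `K` of each other. -/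
noncomputable def blockUnions (fib : (ι → ℤ) → Finset X) (K ℓ : ℕ) : ℕ → (ι → ℤ) → Finset (Finset X)
  | 0, _ => {∅}
  | n + 1, y => (blockSteps ι K).biUnion fun a =>
      (blockUnions fib K ℓ n (y + a)).image fun U => blockNeighbourhood fib K ℓ y ∪ U

variable (fib : (ι → ℤ) → Finset X) (K ℓ : ℕ)

theorem card_blockNeighbourhood_le {Λ : ℕ} (hfib : ∀ z, (fib z).card ≤ Λ) (y : ι → ℤ) :
    (blockNeighbourhood fib K ℓ y).card ≤ ((2 * K + 1) * ℓ) ^ Fintype.card ι * Λ := by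
  refine (Finset.card_biUnion_le_card_mul _ _ Λ fun z _ => hfib z).trans (le_of_eq ?_)
  congr 1
  rw [Fintype.card_piFinset, Finset.prod_congr rfl fun t _ => ?_, Finset.prod_const,
    Finset.card_univ]
  rw [Int.card_Ico, ← sub_mul]
  have : (y t + K + 1 - (y t - K)) * (ℓ : ℤ) = (((2 * K + 1) * ℓ : ℕ) : ℤ) := by
    push_cast
    ring
  rw [this, Int.toNat_natCast]

/-- The bound does not involve the side `ℓ`: a longer block moves the path through as few
neighbouring blocks as a short one, so the entropy cost is paid per block, not per step. -/
theorem card_blockUnions_le (n : ℕ) (y : ι → ℤ) :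
    (blockUnions fib K ℓ n y).card ≤ ((2 * K + 1) ^ Fintype.card ι) ^ n := by
  induction n generalizing y with
  | zero => simp [blockUnions]
  | succ n ih =>
    rw [blockUnions, pow_succ', ← card_blockSteps]
    exact Finset.card_biUnion_le_card_mul _ _ _ fun a _ => Finset.card_image_le.trans
      ((ih (y + a)).trans (by rw [card_blockSteps]))

theorem card_le_of_mem_blockUnions {Λ : ℕ} (hfib : ∀ z, (fib z).card ≤ Λ) {n : ℕ} {y : ι → ℤ}
    {U : Finset X} (hU : U ∈ blockUnions fib K ℓ n y) :
    U.card ≤ n * (((2 * K + 1) * ℓ) ^ Fintype.card ι * Λ) := by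
  induction n generalizing y U with
  | zero =>
    obtain rfl : U = ∅ := by simpa [blockUnions] using hU
    simp
  | succ n ih =>
    simp only [blockUnions, Finset.mem_biUnion, Finset.mem_image] at hU
    obtain ⟨a, -, U', hU', rfl⟩ := hU
    rw [Nat.succ_mul, add_comm (n * _)]
    exact (Finset.card_union_le _ _).trans
      (add_le_add (card_blockNeighbourhood_le fib K ℓ hfib y) (ih hU'))

/-- A path that moves by at most `K` per step stays for `n * ℓ` steps in a union of neighbourhoods
of `n` successive blocks. -/
theorem exists_blockUnion_of_path {φ : X → ι → ℤ} (hφ : ∀ p, p ∈ fib (φ p)) (hℓ : 0 < ℓ) (n : ℕ)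
    (x : ℕ → X) (hx : ∀ i t, |φ (x (i + 1)) t - φ (x i) t| ≤ K) :
    ∃ U ∈ blockUnions fib K ℓ n fun t => φ (x 0) t / ℓ, ∀ i < n * ℓ, x i ∈ U := by
  have hℓ' : (0 : ℤ) < ℓ := by exact_mod_cast hℓ
  have hlip : ∀ (x : ℕ → X), (∀ i t, |φ (x (i + 1)) t - φ (x i) t| ≤ K) →
      ∀ i t, |φ (x i) t - φ (x 0) t| ≤ i * K := by
    intro x hx i t
    induction i with
    | zero => simp
    | succ i ih =>
      have h1 := abs_sub_le (φ (x (i + 1)) t) (φ (x i) t) (φ (x 0) t)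
      have h2 := hx i t
      push_cast
      linarith
  -- In `ℓ` steps a coordinate moves by at most `K * ℓ`, so its block index moves by at most `K`.
  -- The endpoint i = ℓ is included because it starts the next block.
  have hclose : ∀ (x : ℕ → X), (∀ i t, |φ (x (i + 1)) t - φ (x i) t| ≤ K) →
      ∀ i ≤ ℓ, ∀ t, (φ (x 0) t / ℓ - K) * ℓ ≤ φ (x i) t ∧
      φ (x i) t < (φ (x 0) t / ℓ + K + 1) * ℓ := by
    intro x hx i hi t
    have h1 := abs_le.1 (hlip x hx i t)
    have h2 : (i : ℤ) * K ≤ ℓ * K := by gcongr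
    have h3 := Int.ediv_mul_le (φ (x 0) t) hℓ'.ne'
    have h4 := Int.lt_ediv_add_one_mul_self (φ (x 0) t) hℓ'
    constructor <;> linarith
  induction n generalizing x with
  | zero => exact ⟨∅, by simp [blockUnions], by simp⟩
  | succ n ih =>
    obtain ⟨U, hU, hxU⟩ := ih (fun i => x (i + ℓ)) (fun i t => by
      have := hx (i + ℓ) t
      rwa [add_right_comm] at this)
    refine ⟨blockNeighbourhood fib K ℓ (fun t => φ (x 0) t / ℓ) ∪ U, ?_, fun i hi => ?_⟩
    · simp only [blockUnions, Finset.mem_biUnion, Finset.mem_image]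
      refine ⟨fun t => φ (x ℓ) t / ℓ - φ (x 0) t / ℓ, ?_, U, ?_, rfl⟩
      · simp only [blockSteps, Fintype.mem_piFinset, Finset.mem_Icc]
        intro t
        obtain ⟨h1, h2⟩ := hclose x hx ℓ le_rfl t
        have h3 := (Int.le_ediv_iff_mul_le hℓ').2 h1
        have h4 := (Int.ediv_lt_iff_lt_mul hℓ').2 h2
        constructor <;> linarith
      · convert hU using 2
        ext t
        simp
    · rw [Finset.mem_union]
      rcases lt_or_ge i ℓ with h | h
      · refine .inl (Finset.mem_biUnion.2 ⟨φ (x i), ?_, hφ _⟩)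
        simp only [Fintype.mem_piFinset, Finset.mem_Ico]
        exact hclose x hx i h.le
      · right
        have := hxU (i - ℓ) (by rw [Nat.succ_mul] at hi; omega)
        rwa [Nat.sub_add_cancel h] at this

end CoarseGraining

/-! ### Exponential moments -/

section ExponentialMoments

variable {X Ω : Type*} [MeasurableSpace Ω] {P : Measure Ω}

theorem mgf_indicator_one_le [IsProbabilityMeasure P] {E : Set Ω} (hE : MeasurableSet E) :
    mgf (E.indicator 1) P 1 ≤ Real.exp (2 * P.real E) := by
  have h1 : ∀ ω, Real.exp (1 * E.indicator 1 ω) =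
      1 + (Real.exp 1 - 1) * E.indicator (1 : Ω → ℝ) ω := by
    intro ω
    by_cases h : ω ∈ E <;> simp [h]
  rw [mgf]
  simp_rw [h1]
  have hint : Integrable (E.indicator (1 : Ω → ℝ)) P := (integrable_const 1).indicator hE
  rw [integral_add (integrable_const _) (hint.const_mul _), integral_const_mul,
    integral_indicator_one hE]
  have h2 : Real.exp 1 - 1 ≤ 2 := by linarith [Real.exp_one_lt_three]
  have h3 := Real.add_one_le_exp (2 * P.real E)
  have h4 : (Real.exp 1 - 1) * P.real E ≤ 2 * P.real E :=
    mul_le_mul_of_nonneg_right h2 measureReal_nonneg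
  simp
  linarith

/-- The largest number of events that occur among the members of a finite family of finite sets of
independent events is dominated by a random variable of small expectation. -/
theorem exists_integrable_ge_sum_indicator {E : X → Set Ω} (hE : ∀ x, MeasurableSet (E x))
    (hind : iIndepFun (fun x => (E x).indicator (1 : Ω → ℝ)) P) {p : ℝ} (hp0 : 0 ≤ p)
    (hp : ∀ x, P.real (E x) = p) (𝓕 : Finset (Finset X)) {M c : ℕ} (hM : 0 < M) (hcard : 𝓕.card ≤ M)
    (hc : ∀ U ∈ 𝓕, U.card ≤ c) :
    ∃ Ψ : Ω → ℝ, Integrable Ψ P ∧ ∫ ω, Ψ ω ∂P ≤ Real.log M + 2 * p * c ∧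
      ∀ U ∈ 𝓕, ∀ ω, ∑ x ∈ U, (E x).indicator (1 : Ω → ℝ) ω ≤ Ψ ω := by
  have := hind.isProbabilityMeasure
  set Q : ℝ := Real.log M + 2 * p * c with hQ
  have hmeas : ∀ x, Measurable ((E x).indicator (1 : Ω → ℝ)) := fun x =>
    measurable_one.indicator (hE x)
  have hle : ∀ (U : Finset X) ω, ∑ x ∈ U, (E x).indicator (1 : Ω → ℝ) ω ≤ U.card := by
    intro U ω
    refine (Finset.sum_le_card_nsmul _ _ 1 fun x _ => ?_).trans (by simp)
    exact Set.indicator_le_self' (fun _ _ => zero_le_one) ω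
  have hint : ∀ U : Finset X,
      Integrable (fun ω => Real.exp (∑ x ∈ U, (E x).indicator (1 : Ω → ℝ) ω)) P := by
    intro U
    refine Integrable.of_bound (by fun_prop) (Real.exp U.card) (ae_of_all _ fun ω => ?_)
    rw [Real.norm_of_nonneg (Real.exp_nonneg _)]
    exact Real.exp_le_exp.2 (hle U ω)
  have hmoment : ∀ U ∈ 𝓕, ∫ ω, Real.exp (∑ x ∈ U, (E x).indicator (1 : Ω → ℝ) ω) ∂P ≤
      Real.exp (2 * p * c) := by
    intro U hU
    have h1 := hind.mgf_sum (t := 1) hmeas U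
    simp only [mgf, one_mul, Finset.sum_apply] at h1
    rw [h1]
    have h2 : ∀ x ∈ U, ∫ ω, Real.exp ((E x).indicator (1 : Ω → ℝ) ω) ∂P ≤ Real.exp (2 * p) := by
      intro x _
      have := mgf_indicator_one_le (P := P) (hE x)
      simpa only [mgf, one_mul, hp] using this
    refine (Finset.prod_le_prod (fun x _ => integral_nonneg fun ω => Real.exp_nonneg _) h2).trans ?_
    rw [Finset.prod_const, ← Real.exp_nat_mul]
    refine Real.exp_le_exp.2 ?_
    have h3 : (U.card : ℝ) ≤ c := by exact_mod_cast hc U hU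
    have := mul_le_mul_of_nonneg_right h3 hp0
    linarith
  -- From s ≤ Q - 1 + exp(s - Q), adding the exponential terms of all sets dominates every sum at
  -- once. The value of `Q` makes these terms add up to at most 1 in expectation.
  refine ⟨fun ω => Q - 1 + ∑ U ∈ 𝓕, Real.exp (-Q) *
    Real.exp (∑ x ∈ U, (E x).indicator (1 : Ω → ℝ) ω), ?_, ?_, ?_⟩
  · exact (integrable_const _).add (integrable_finsetSum _ fun U _ => (hint U).const_mul _)
  · rw [integral_add (integrable_const _)
      (integrable_finsetSum _ fun U _ => (hint U).const_mul _),
      integral_finsetSum _ fun U _ => (hint U).const_mul _]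
    simp only [integral_const, probReal_univ, smul_eq_mul, one_mul, integral_const_mul]
    have h1 : ∑ U ∈ 𝓕, Real.exp (-Q) * ∫ ω, Real.exp (∑ x ∈ U, (E x).indicator (1 : Ω → ℝ) ω) ∂P ≤
        𝓕.card * (Real.exp (-Q) * Real.exp (2 * p * c)) := by
      rw [← nsmul_eq_mul]
      exact Finset.sum_le_card_nsmul _ _ _ fun U hU =>
        mul_le_mul_of_nonneg_left (hmoment U hU) (Real.exp_nonneg _)
    have h2 : (𝓕.card : ℝ) ≤ M := by exact_mod_cast hcard
    have hM' : (0 : ℝ) < M := by exact_mod_cast hM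
    have h3 : (M : ℝ) * (Real.exp (-Q) * Real.exp (2 * p * c)) = 1 := by
      rw [← Real.exp_add, hQ]
      have : -(Real.log M + 2 * p * c) + 2 * p * c = -Real.log M := by ring
      rw [this, Real.exp_neg, Real.exp_log hM', mul_inv_cancel₀ hM'.ne']
    have h4 := mul_le_mul_of_nonneg_right h2
      (show 0 ≤ Real.exp (-Q) * Real.exp (2 * p * c) by positivity)
    linarith
  · intro U hU ω
    have h1 := Real.add_one_le_exp (-Q + ∑ x ∈ U, (E x).indicator (1 : Ω → ℝ) ω)
    rw [Real.exp_add] at h1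
    have h2 := Finset.single_le_sum (f := fun U => Real.exp (-Q) *
      Real.exp (∑ x ∈ U, (E x).indicator (1 : Ω → ℝ) ω)) (fun U _ => by positivity) hU
    beta_reduce at h2
    linarith

end ExponentialMoments

/-! ### Chains of services as injective lattice paths -/

namespace ForkJoinNetwork

variable {V : Type*} {N : ForkJoinNetwork V} {b : ℕ+}

/-- A potential that increases by at least one from a service to those that wait for it. -/
theorem Precedes.potential_lt {l : V → ℤ} {L : ℕ}
    (hl : ∀ u v, N.Arc u v → 1 ≤ l v - l u ∧ l v - l u ≤ L) {x y : ℕ × V}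
    (h : N.Precedes b x y) :
    (L + 1) * (x.1 : ℤ) + l x.2 + 1 ≤ (L + 1) * (y.1 : ℤ) + l y.2 := by
  rcases h with ⟨h, h'⟩ | ⟨h, h'⟩ | ⟨h, h'⟩
  · have := hl _ _ h
    rw [h']
    linarith
  · rw [h', h]
    push_cast
    linarith [(Nat.cast_nonneg L : (0 : ℤ) ≤ L)]
  -- Blocking runs against an arc and lowers the label by at most L, while the customer index gains
  -- b ≥ 1; the weight L + 1 on the index keeps the net gain at least 1.
  · have h1 := hl _ _ h
    have h2 : (1 : ℤ) ≤ (b : ℕ) := by exact_mod_cast b.pos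
    rw [h']
    push_cast
    nlinarith [(Nat.cast_nonneg L : (0 : ℤ) ≤ L)]

theorem potential_path_le {l : V → ℤ} {L : ℕ}
    (hl : ∀ u v, N.Arc u v → 1 ≤ l v - l u ∧ l v - l u ≤ L) {n : ℕ} {x : ℕ → ℕ × V}
    (hx : ∀ i < n, N.Precedes b (x (i + 1)) (x i)) (i j : ℕ) (h : i + j ≤ n) :
    (L + 1) * ((x (i + j)).1 : ℤ) + l (x (i + j)).2 + j ≤ (L + 1) * ((x i).1 : ℤ) + l (x i).2 := by
  induction j with
  | zero => simp
  | succ j ih =>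
    have h1 := ih (by omega)
    have h2 := (hx (i + j) (by omega)).potential_lt hl
    rw [← add_assoc i j 1]
    push_cast
    linarith

/-- The potential strictly decreases along a chain. Injectivity turns a sum along the chain into a
sum over a set of distinct, hence independent, services. -/
theorem path_injOn {l : V → ℤ} {L : ℕ}
    (hl : ∀ u v, N.Arc u v → 1 ≤ l v - l u ∧ l v - l u ≤ L) {n : ℕ} {x : ℕ → ℕ × V}
    (hx : ∀ i < n, N.Precedes b (x (i + 1)) (x i)) : Set.InjOn x (Finset.range (n + 1)) := by
  have key : ∀ i j, i < j → j ≤ n → x i ≠ x j := by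
    intro i j hij hj heq
    obtain ⟨k, rfl⟩ := Nat.exists_eq_add_of_lt hij
    have := potential_path_le hl hx i (k + 1) (by omega)
    rw [← add_assoc, ← heq] at this
    push_cast at this
    linarith [(Nat.cast_nonneg k : (0 : ℤ) ≤ k)]
  intro i hi j hj hij
  simp only [Finset.coe_range, Set.mem_Iio] at hi hj
  by_contra hne
  rcases lt_or_gt_of_ne hne with h | h
  · exact key i j h (by omega) hij
  · exact key j i h (by omega) hij.symm

theorem path_length_le {l : V → ℤ} {L R : ℕ}
    (hl : ∀ u v, N.Arc u v → 1 ≤ l v - l u ∧ l v - l u ≤ L) (hR : ∀ u v, l v - l u ≤ R) {n : ℕ}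
    {x : ℕ → ℕ × V} (hx : ∀ i < n, N.Precedes b (x (i + 1)) (x i)) :
    n ≤ (L + 1) * (x 0).1 + R := by
  have h1 := potential_path_le hl hx 0 n (by omega)
  rw [zero_add] at h1
  have h2 := hR (x n).2 (x 0).2
  have h3 : (0 : ℤ) ≤ (L + 1) * ((x n).1 : ℤ) := by positivity
  zify
  linarith

theorem path_fst_le {n : ℕ} {x : ℕ → ℕ × V} (hx : ∀ i < n, N.Precedes b (x (i + 1)) (x i)) {i : ℕ}
    (hi : i ≤ n) : (x i).1 ≤ (x 0).1 := by
  induction i with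
  | zero => exact le_rfl
  | succ i ih => exact (hx i (by omega)).fst_le.trans (ih (by omega))

/-- The position of a service: the index of the customer and the coordinates of the node. -/
def position {k : ℕ} (r : V → Fin k → ℤ) (x : ℕ × V) : Option (Fin k) → ℤ
  | none => x.1
  | some t => r x.2 t

theorem Precedes.abs_position_sub_le {k : ℕ} {r : V → Fin k → ℤ}
    (hr : ∀ u v, N.Arc u v → ∀ t, |r u t - r v t| ≤ 1) {x y : ℕ × V} (h : N.Precedes b x y)
    (t : Option (Fin k)) : |position r x t - position r y t| ≤ (b : ℕ) := by
  have hb : (1 : ℤ) ≤ (b : ℕ) := by exact_mod_cast b.pos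
  rcases h with ⟨h, h'⟩ | ⟨h, h'⟩ | ⟨h, h'⟩
  · cases t with
    | none => simp [position, h']
    | some t => exact (hr _ _ h t).trans hb
  · cases t with
    | none => simpa [position, h'] using hb
    | some t => simp [position, h]
  · cases t with
    | none => simp [position, h']
    | some t =>
      rw [abs_sub_comm]
      exact (hr _ _ h t).trans hb

open Classical in
/-- The services at a given position. -/
noncomputable def servicesAt [Fintype V] {k : ℕ} (r : V → Fin k → ℤ) (z : Option (Fin k) → ℤ) :
    Finset (ℕ × V) :=
  -- Negative customer coordinates are sent to customer 0. This is harmless: only the size bound and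
  -- membership at a service's own position are used.
  {(z none).toNat} ×ˢ Finset.univ.filter fun v => r v = fun t => z (some t)

theorem mem_servicesAt_position [Fintype V] {k : ℕ} (r : V → Fin k → ℤ) (x : ℕ × V) :
    x ∈ servicesAt r (position r x) := by
  refine Finset.mem_product.2 ⟨by simp [position], Finset.mem_filter.2 ⟨Finset.mem_univ _, rfl⟩⟩

end ForkJoinNetwork

/-- The constant in the bound on the number of long services along a path. -/
noncomputable def pathConstant (b : ℕ+) (k Λ : ℕ) : ℝ :=
  -- The entropy of one block transition, plus the exponential moment cost of one block
  -- neighbourhood, whose factor p ℓ^(k+1) is bounded by 2^(k+1).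
  Real.log ((2 * b + 1) ^ (k + 1) : ℕ) + 2 * ((2 * b + 1) ^ (k + 1) * Λ * 2 ^ (k + 1) : ℕ)

theorem pathConstant_nonneg (b : ℕ+) (k Λ : ℕ) : 0 ≤ pathConstant b k Λ :=
  add_nonneg (Real.log_natCast_nonneg _) (by positivity)

/-- A block side for which the expected number of rare points in a block is of order one. -/
theorem exists_block_side (d : ℕ) (hd : 0 < d) {p : ℝ} (hp0 : 0 < p) (hp1 : p ≤ 1) :
    ∃ ℓ : ℕ, 0 < ℓ ∧ (1 : ℝ) / ℓ ≤ p ^ ((1 : ℝ) / d) ∧ p * (ℓ : ℝ) ^ d ≤ 2 ^ d := by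
  set q : ℝ := p ^ ((1 : ℝ) / d) with hq
  have hd' : (0 : ℝ) < d := by exact_mod_cast hd
  have hq0 : 0 < q := Real.rpow_pos_of_pos hp0 _
  have hq1 : q ≤ 1 := Real.rpow_le_one hp0.le hp1 (by positivity)
  have hqd : q ^ d = p := by
    rw [hq, ← Real.rpow_natCast, ← Real.rpow_mul hp0.le, one_div, inv_mul_cancel₀ hd'.ne',
      Real.rpow_one]
  have hinv : 1 ≤ 1 / q := (one_le_div hq0).2 hq1
  refine ⟨⌈1 / q⌉₊, Nat.ceil_pos.2 (by positivity), ?_, ?_⟩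
  · rw [one_div_le (by positivity) hq0]
    exact Nat.le_ceil _
  · have h1 : (⌈1 / q⌉₊ : ℝ) ≤ 2 * (1 / q) := by
      have := Nat.ceil_lt_add_one (show 0 ≤ 1 / q by positivity)
      linarith
    calc p * (⌈1 / q⌉₊ : ℝ) ^ d ≤ q ^ d * (2 * (1 / q)) ^ d := by
          rw [hqd]
          gcongr
      _ = 2 ^ d := by
          rw [← mul_pow]
          congr 1
          field_simp

/-! ### Counting long services along a chain -/

namespace IIDServices

open ForkJoinNetwork

variable {V Ω : Type*} [MeasurableSpace Ω] {P : Measure Ω} [IsProbabilityMeasure P]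
  {F : Measure ℝ≥0} {S : ℕ → V → Ω → ℝ≥0} [Fintype V] (N : ForkJoinNetwork V) (b : ℕ+)

/-- The number of services longer than `a` along a path of length at most `H` is dominated by a
random variable of expectation at most of order `H * p ^ (1 / (k + 1)) + 1`, where `p` is the
probability that a service is longer than `a` and `k` is the number of coordinates of a node. -/
theorem exists_integrable_ge_path_count (h : IIDServices P F S) {k Λ : ℕ} {r : V → Fin k → ℤ}
    (hr : ∀ u v, N.Arc u v → ∀ t, |r u t - r v t| ≤ 1)
    (hΛ : ∀ z, (servicesAt r z).card ≤ Λ) (m : ℕ) (v : V) (H : ℕ) {a : ℝ}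
    (ha : 0 < F.real {y : ℝ≥0 | a < y}) :
    ∃ Ψ : Ω → ℝ, Integrable Ψ P ∧
      ∫ ω, Ψ ω ∂P ≤ pathConstant b k Λ *
        (H * F.real {y : ℝ≥0 | a < y} ^ ((1 : ℝ) / (k + 1 : ℕ)) + 1) ∧
      ∀ ω (n : ℕ) (x : ℕ → ℕ × V), x 0 = (m, v) → (∀ i < n, N.Precedes b (x (i + 1)) (x i)) →
        Set.InjOn x (Finset.range (n + 1)) → n ≤ H →
        ∑ i ∈ Finset.range (n + 1), (Set.Ioi a).indicator (1 : ℝ → ℝ) (S (x i).1 (x i).2 ω) ≤ Ψ ω := by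
  classical
  have : Nonempty V := ⟨v⟩
  have := h.isProbabilityMeasure
  set p := F.real {y : ℝ≥0 | a < y} with hp
  have hp1 : p ≤ 1 := measureReal_le_one
  obtain ⟨ℓ, hℓ, hℓ1, hℓ2⟩ := exists_block_side (k + 1) k.succ_pos ha hp1
  -- Rounding up gives n₀ ℓ > H, so `n₀` blocks cover all the points of a path of at most `H` steps.
  set n₀ : ℕ := H / ℓ + 1 with hn₀
  have hcardι : Fintype.card (Option (Fin k)) = k + 1 := by simp
  set E : ℕ × V → Set Ω := fun x => {ω | a < S x.1 x.2 ω} with hE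
  have hEind : ∀ x ω, (E x).indicator (1 : Ω → ℝ) ω =
      (Set.Ioi a).indicator (1 : ℝ → ℝ) (S x.1 x.2 ω) := fun x ω => rfl
  have hEmeas : ∀ x, MeasurableSet (E x) := fun x =>
    h.measurable x.1 x.2 (IsRegularlyVarying.measurableSet_tail a)
  have hind : iIndepFun (fun x => (E x).indicator (1 : Ω → ℝ)) P :=
    h.indep.comp (fun _ (y : ℝ≥0) => (Set.Ioi a).indicator (1 : ℝ → ℝ) y) fun _ =>
      (measurable_one.indicator measurableSet_Ioi).comp measurable_coe_nnreal_real
  obtain ⟨Ψ, hΨ1, hΨ2, hΨ3⟩ := exists_integrable_ge_sum_indicator hEmeas hind ha.le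
    (fun x => h.measureReal_tail x.1 x.2 a)
    (blockUnions (servicesAt r) b ℓ n₀ fun t => position r (m, v) t / ℓ)
    (M := ((2 * b + 1) ^ Fintype.card (Option (Fin k))) ^ n₀) (by positivity)
    (card_blockUnions_le _ _ _ _ _) fun U hU => card_le_of_mem_blockUnions _ _ _ hΛ hU
  refine ⟨Ψ, hΨ1, hΨ2.trans ?_, ?_⟩
  · rw [hcardι]
    have h1 : (n₀ : ℝ) ≤ H * p ^ ((1 : ℝ) / (k + 1 : ℕ)) + 1 := by
      rw [hn₀]
      push_cast
      gcongr
      refine Nat.cast_div_le.trans ?_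
      rw [div_eq_mul_one_div]
      gcongr
      exact_mod_cast hℓ1
    refine le_trans (le_of_eq_of_le ?_ (mul_le_mul_of_nonneg_right
      (show Real.log ((2 * b + 1) ^ (k + 1) : ℕ) +
        2 * ((2 * b + 1) ^ (k + 1) * Λ * (p * (ℓ : ℝ) ^ (k + 1))) ≤ pathConstant b k Λ from ?_)
      n₀.cast_nonneg)) (mul_le_mul_of_nonneg_left h1 (pathConstant_nonneg b k Λ))
    · rw [Nat.cast_pow, Real.log_pow, mul_pow (2 * (b : ℕ) + 1)]
      push_cast
      ring
    · rw [pathConstant]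
      push_cast
      gcongr
  · intro ω n x hx0 hx hinj hn
    -- The coarse graining wants an infinite path, so the chain is frozen at its last service.
    obtain ⟨U, hU, hxU⟩ := exists_blockUnion_of_path (servicesAt r) b ℓ
      (φ := position r) (mem_servicesAt_position r) hℓ n₀ (fun i => x (min i n)) fun i t => by
        rcases lt_or_ge i n with hi | hi
        · rw [min_eq_left hi.le, min_eq_left (Nat.succ_le_of_lt hi)]
          exact (hx i hi).abs_position_sub_le hr t
        · simp [min_eq_right hi, min_eq_right (hi.trans (Nat.le_succ i))]
    simp only [Nat.zero_min, hx0] at hU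
    refine le_trans ?_ (hΨ3 U hU ω)
    simp only [hEind]
    rw [← Finset.sum_image (f := fun y : ℕ × V =>
      (Set.Ioi a).indicator (1 : ℝ → ℝ) (S y.1 y.2 ω)) hinj]
    refine Finset.sum_le_sum_of_subset_of_nonneg ?_ fun y _ _ =>
      Set.indicator_nonneg (fun _ _ => zero_le_one) _
    intro y hy
    obtain ⟨i, hi, rfl⟩ := Finset.mem_image.1 hy
    have hi' : i ≤ n := Nat.lt_succ_iff.1 (Finset.mem_range.1 hi)
    have := hxU i (by
      have := Nat.lt_div_mul_add (a := H) hℓ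
      rw [hn₀, Nat.succ_mul]
      omega)
    rwa [min_eq_left hi'] at this

end IIDServices

/-! ### A bound on the time constant uniform in the size of the network -/

namespace IIDServices

open ForkJoinNetwork

variable {V Ω : Type*} [MeasurableSpace Ω] {P : Measure Ω} [IsProbabilityMeasure P]
  {F : Measure ℝ≥0} {S : ℕ → V → Ω → ℝ≥0} [Fintype V] (N : ForkJoinNetwork V) (b : ℕ+)

/-- The dyadic decomposition is applied to each service of the chain. Levels below 2^J are counted
along the chain; services above 2^J are bounded crudely by all those of the first m + 1 customers.
-/
theorem integral_completionTime_le (h : IIDServices P F S)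
    (hF : ∫⁻ x : ℝ≥0, (x : ℝ≥0∞) ∂F ≠ ∞) (hpos : ∀ x : ℝ, 0 < F.real {y : ℝ≥0 | x < y})
    {l : V → ℤ} {L R : ℕ} (hl : ∀ u v, N.Arc u v → 1 ≤ l v - l u ∧ l v - l u ≤ L)
    (hR : ∀ u v, l v - l u ≤ R) {k Λ : ℕ} {r : V → Fin k → ℤ}
    (hr : ∀ u v, N.Arc u v → ∀ t, |r u t - r v t| ≤ 1)
    (hΛ : ∀ z, (servicesAt r z).card ≤ Λ) (m : ℕ) (v : V) (J : ℕ) :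
    ∫ ω, (N.completionTime b (fun k u => S k u ω) m v : ℝ) ∂P ≤
      (((L + 1) * m + R : ℕ) + 1) +
      ∑ j ∈ Finset.range J, 2 ^ (j + 1) * (pathConstant b k Λ * (((L + 1) * m + R : ℕ) *
        F.real {y : ℝ≥0 | (2 : ℝ) ^ j < y} ^ ((1 : ℝ) / (k + 1 : ℕ)) + 1)) +
      (m + 1) * (Fintype.card V * ∫ y, (Set.Ioi ((2 : ℝ) ^ J)).indicator id (y : ℝ) ∂F) := by
  classical
  set H := (L + 1) * m + R with hH
  choose Ψ hΨ1 hΨ2 hΨ3 using fun j : ℕ =>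
    h.exists_integrable_ge_path_count N b hr hΛ m v H (hpos (2 ^ j))
  set g : ℝ≥0 → ℝ := fun y => (Set.Ioi ((2 : ℝ) ^ J)).indicator id (y : ℝ) with hg
  have hg0 : ∀ y, 0 ≤ g y := fun y => by
    by_cases hy : (2 : ℝ) ^ J < y <;> simp [hg, hy]
  have hgle : ∀ y, g y ≤ y := fun y => by
    by_cases hy : (2 : ℝ) ^ J < y <;> simp [hg, hy]
  have hgm : Measurable g :=
    (measurable_id.indicator measurableSet_Ioi).comp measurable_coe_nnreal_real
  have hgint : ∀ i u, Integrable (fun ω => g (S i u ω)) P := fun i u =>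
    (h.integrable_service hF i u).mono' (hgm.comp (h.measurable i u)).aestronglyMeasurable
      (ae_of_all _ fun ω => by
        rw [Real.norm_of_nonneg (hg0 _)]
        exact hgle _)
  have hgE : ∀ i u, ∫ ω, g (S i u ω) ∂P = ∫ y, g y ∂F := fun i u => by
    rw [← h.law i u, integral_map (h.measurable i u).aemeasurable hgm.aestronglyMeasurable]
  have hpt : ∀ ω, (N.completionTime b (fun k u => S k u ω) m v : ℝ) ≤
      (H + 1) + ∑ j ∈ Finset.range J, 2 ^ (j + 1) * Ψ j ω +
        ∑ i ∈ Finset.range (m + 1), ∑ u, g (S i u ω) := by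
    intro ω
    obtain ⟨n, x, hx0, hx, hsum⟩ := N.exists_path_completionTime b (fun k u => S k u ω) m v
    have hinj := path_injOn hl hx
    have hn : n ≤ H := by
      have := path_length_le hl hR hx
      rwa [hx0] at this
    rw [hsum]
    push_cast
    refine (Finset.sum_le_sum fun i _ => le_one_add_sum_dyadic (S (x i).1 (x i).2 ω) J).trans ?_
    rw [Finset.sum_add_distrib, Finset.sum_add_distrib]
    refine add_le_add (add_le_add ?_ ?_) ?_
    · have : (n : ℝ) ≤ H := by exact_mod_cast hn
      simpa using this
    · rw [Finset.sum_comm]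
      refine Finset.sum_le_sum fun j _ => ?_
      rw [← Finset.mul_sum]
      exact mul_le_mul_of_nonneg_left (hΨ3 j ω n x hx0 hx hinj hn) (by positivity)
    · change ∑ i ∈ Finset.range (n + 1), g (S (x i).1 (x i).2 ω) ≤ _
      rw [← Finset.sum_image (f := fun y : ℕ × V => g (S y.1 y.2 ω)) hinj, ← Finset.sum_product']
      refine Finset.sum_le_sum_of_subset_of_nonneg ?_ fun y _ _ => hg0 _
      intro y hy
      obtain ⟨i, hi, rfl⟩ := Finset.mem_image.1 hy
      have := path_fst_le hx (Nat.lt_succ_iff.1 (Finset.mem_range.1 hi))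
      rw [hx0] at this
      simpa using Nat.lt_succ_of_le this
  have hi2 : Integrable (fun ω => ∑ j ∈ Finset.range J, 2 ^ (j + 1) * Ψ j ω) P :=
    integrable_finsetSum _ fun j _ => (hΨ1 j).const_mul _
  have hi3 : Integrable (fun ω => ∑ i ∈ Finset.range (m + 1), ∑ u, g (S i u ω)) P :=
    integrable_finsetSum _ fun i _ => integrable_finsetSum _ fun u _ => hgint i u
  have hi12 : Integrable (fun ω => ((H : ℝ) + 1) + ∑ j ∈ Finset.range J, 2 ^ (j + 1) * Ψ j ω) P :=
    (integrable_const _).add hi2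
  refine (integral_mono (h.integrable_completionTime N b hF m v) (hi12.add hi3) hpt).trans ?_
  rw [integral_add' hi12 hi3, integral_add (integrable_const _) hi2,
    integral_finsetSum _ fun j _ => (hΨ1 j).const_mul _,
    integral_finsetSum _ fun i _ => integrable_finsetSum _ fun u _ => hgint i u]
  simp only [integral_const, probReal_univ, one_smul, integral_const_mul]
  refine add_le_add (add_le_add le_rfl (Finset.sum_le_sum fun j _ =>
    mul_le_mul_of_nonneg_left (hΨ2 j) (by positivity))) (le_of_eq ?_)
  simp only [integral_finsetSum _ fun u _ => hgint _ u, hgE]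
  simp

/-- A bound on the time constant that depends on the network only through the increments of a
labelling and the number of nodes with the same coordinates. -/
theorem timeConstant_le (h : IIDServices P F S) {α : ℝ} (hα : 1 < α)
    (hF : IsRegularlyVarying F α)
    {l : V → ℤ} {L : ℕ} (hl : ∀ u v, N.Arc u v → 1 ≤ l v - l u ∧ l v - l u ≤ L)
    {k Λ : ℕ} (hk : (k : ℝ) < α - 1) {r : V → Fin k → ℤ}
    (hr : ∀ u v, N.Arc u v → ∀ t, |r u t - r v t| ≤ 1)
    (hΛ : ∀ z, (servicesAt r z).card ≤ Λ) {γ : ℝ} (v : V)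
    (hγ : Tendsto (fun m : ℕ => (∫ ω, (N.completionTime b (fun k u => S k u ω) m v : ℝ) ∂P) / m)
      atTop (𝓝 γ)) :
    γ ≤ (L + 1) * (1 + pathConstant b k Λ * ∑' j : ℕ,
      (2 : ℝ) ^ (j + 1) * F.real {y : ℝ≥0 | (2 : ℝ) ^ j < y} ^ ((1 : ℝ) / (k + 1 : ℕ))) := by
  have : Nonempty V := ⟨v⟩
  have := h.isProbabilityMeasure
  have hmean := hF.lintegral_ne_top hα
  have hsum := hF.summable_dyadic (d := (k + 1 : ℕ)) (by positivity) (by push_cast; linarith)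
  set a : ℕ → ℝ := fun j =>
    (2 : ℝ) ^ (j + 1) * F.real {y : ℝ≥0 | (2 : ℝ) ^ j < y} ^ ((1 : ℝ) / (k + 1 : ℕ)) with ha
  have ha0 : ∀ j, 0 ≤ a j := fun j =>
    mul_nonneg (by positivity) (Real.rpow_nonneg measureReal_nonneg _)
  set C := pathConstant b k Λ with hC
  have hC0 : 0 ≤ C := pathConstant_nonneg b k Λ
  obtain ⟨R, hR⟩ : ∃ R : ℕ, ∀ u v, l v - l u ≤ R := by
    obtain ⟨R, hR⟩ := (Set.finite_range fun x : V × V => l x.2 - l x.1).bddAbove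
    exact ⟨R.toNat, fun u v => (hR ⟨(u, v), rfl⟩).trans (Int.self_le_toNat R)⟩
  set ρ : ℕ → ℝ := fun J => ∫ y : ℝ≥0, (Set.Ioi ((2 : ℝ) ^ J)).indicator id (y : ℝ) ∂F with hρ
  have hbound : ∀ J, γ ≤ (L + 1) * (1 + C * ∑' j, a j) + Fintype.card V * ρ J := by
    intro J
    set G : ℝ := ∑ j ∈ Finset.range J, (2 : ℝ) ^ (j + 1) with hG
    -- `B` collects what stays bounded in `m`. With `J` fixed it vanishes as `m` tends to infinity;
    -- only afterwards does `J` grow, which removes the crude term with its factor |V|.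
    set B : ℝ := R + 1 + C * (R * ∑' j, a j) + C * G + Fintype.card V * ρ J with hB
    have hlim : Tendsto (fun m : ℕ =>
        ((L + 1) * (1 + C * ∑' j, a j) + Fintype.card V * ρ J) + B / (m : ℝ)) atTop
        (𝓝 (((L + 1) * (1 + C * ∑' j, a j) + Fintype.card V * ρ J) + 0)) :=
      tendsto_const_nhds.add (tendsto_const_div_atTop_nhds_zero_nat B)
    rw [add_zero] at hlim
    refine le_of_tendsto_of_tendsto hγ hlim ?_
    filter_upwards [eventually_gt_atTop 0] with m hm
    have hm' : (0 : ℝ) < m := by exact_mod_cast hm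
    rw [div_le_iff₀ hm', add_mul, div_mul_cancel₀ _ hm'.ne']
    refine (h.integral_completionTime_le N b hmean hF.tail_pos hl hR hr hΛ m v J).trans ?_
    have h1 : ∑ j ∈ Finset.range J, 2 ^ (j + 1) * (C * (((L + 1) * m + R : ℕ) *
        F.real {y : ℝ≥0 | (2 : ℝ) ^ j < y} ^ ((1 : ℝ) / (k + 1 : ℕ)) + 1)) =
        C * (((L + 1) * m + R : ℕ) * ∑ j ∈ Finset.range J, a j) + C * G := by
      rw [hG, Finset.mul_sum, Finset.mul_sum, Finset.mul_sum, ← Finset.sum_add_distrib]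
      refine Finset.sum_congr rfl fun j _ => ?_
      simp only [ha]
      ring
    have h2 : C * (((L + 1) * m + R : ℕ) * ∑ j ∈ Finset.range J, a j) ≤
        C * (((L + 1) * m + R : ℕ) * ∑' j, a j) := by
      gcongr
      exact hsum.sum_le_tsum _ fun j _ => ha0 j
    rw [h1, hB]
    push_cast at h2 ⊢
    linarith
  have hρlim : Tendsto ρ atTop (𝓝 0) := by
    have hint : Integrable (fun y : ℝ≥0 => (y : ℝ)) F := by
      refine ⟨measurable_coe_nnreal_real.aestronglyMeasurable, ?_⟩
      rw [hasFiniteIntegral_iff_ofReal (ae_of_all _ fun y => NNReal.coe_nonneg _)]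
      simpa only [ENNReal.ofReal_coe_nnreal] using hmean.lt_top
    have h0 : ∫ _ : ℝ≥0, (0 : ℝ) ∂F = 0 := integral_zero _ _
    rw [← h0]
    refine tendsto_integral_of_dominated_convergence (fun y : ℝ≥0 => (y : ℝ)) (fun J =>
      ((measurable_id.indicator measurableSet_Ioi).comp
        measurable_coe_nnreal_real).aestronglyMeasurable) hint (fun J => ae_of_all _ fun y => ?_)
      (ae_of_all _ fun y => ?_)
    · by_cases hy : (2 : ℝ) ^ J < y <;> simp [hy]
    · refine tendsto_const_nhds.congr' ?_
      filter_upwards [(tendsto_pow_atTop_atTop_of_one_lt (one_lt_two (α := ℝ))).eventually_ge_atTop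
        (y : ℝ)] with J hJ
      rw [Set.indicator_of_notMem (by simpa using hJ)]
  have hlim := (hρlim.const_mul (Fintype.card V : ℝ)).const_add
    ((L + 1) * (1 + C * ∑' j, a j))
  rw [mul_zero, add_zero] at hlim
  exact ge_of_tendsto' hlim hbound

end IIDServices

/-! ### Coordinates from resolving sets and labellings from the minimum level -/

namespace ForkJoinNetwork

section Coordinates

variable {V : Type*} (N : ForkJoinNetwork V)

theorem distSet_le_add_one {u v : V} (h : N.graph.Adj u v) (W : Set V) :
    N.distSet u W ≤ N.distSet v W + 1 := by
  rw [distSet, distSet, ENat.iInf_add]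
  refine le_iInf fun w => ?_
  rcases em (w ∈ W) with hw | hw
  · simp only [hw, iInf_pos]
    refine (iInf₂_le w hw).trans ((SimpleGraph.edist_triangle (v := v)).trans ?_)
    rw [SimpleGraph.edist_eq_one_iff_adj.2 h, add_comm]
  · simp [hw]

theorem distSet_ne_top {W : Set V} (hW : W.Nonempty) (v : V) : N.distSet v W ≠ ⊤ := by
  obtain ⟨w, hw⟩ := hW
  refine ne_top_of_le_ne_top ?_ (iInf₂_le w hw)
  exact SimpleGraph.edist_ne_top_iff_reachable.2
    ((show N.graph.Connected from N.connected).preconnected v w)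

theorem distSet_empty (v : V) : N.distSet v ∅ = ⊤ := by
  simp [distSet]

/-- `toNat` confuses ⊤ with 0, but by connectedness ⊤ occurs only for the empty set, and then at
every node. -/
theorem distSet_eq_of_toNat_eq {W : Set V} {u v : V}
    (h : (N.distSet u W).toNat = (N.distSet v W).toNat) : N.distSet u W = N.distSet v W := by
  rcases W.eq_empty_or_nonempty with rfl | hW
  · rw [distSet_empty, distSet_empty]
  · rw [← ENat.natCast_toNat (N.distSet_ne_top hW u), h, ENat.natCast_toNat (N.distSet_ne_top hW v)]

theorem abs_distSet_sub_le {u v : V} (h : N.graph.Adj u v) (W : Set V) :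
    |((N.distSet u W).toNat : ℤ) - (N.distSet v W).toNat| ≤ 1 := by
  rcases W.eq_empty_or_nonempty with rfl | hW
  · simp [distSet_empty]
  · have key : ∀ {u v : V}, N.graph.Adj u v →
        (N.distSet u W).toNat ≤ (N.distSet v W).toNat + 1 := by
      intro u v h
      have := N.distSet_le_add_one h W
      rw [← ENat.natCast_toNat (N.distSet_ne_top hW u),
        ← ENat.natCast_toNat (N.distSet_ne_top hW v)] at this
      exact_mod_cast this
    have h1 := key h
    have h2 := key h.symm
    rw [abs_le]
    constructor <;> linarith

theorem graph_adj_of_arc {u v : V} (h : N.Arc u v) : N.graph.Adj u v := by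
  rw [graph, SimpleGraph.fromRel_adj]
  refine ⟨?_, .inl h⟩
  rintro rfl
  exact N.acyclic u (.single h)

/-- Resolving sets provide coordinates that vary slowly along arcs and are shared by few nodes. -/
theorem IsExtendedResolving.exists_coordinates [Fintype V] {N : ForkJoinNetwork V} {Λ j k : ℕ}
    (hj : j ≤ k) {W : Fin j → Set V} (h : N.IsExtendedResolving Λ W) :
    ∃ r : V → Fin k → ℤ, (∀ u v, N.Arc u v → ∀ t, |r u t - r v t| ≤ 1) ∧
      ∀ z, (servicesAt r z).card ≤ Λ := by
  classical
  -- Missing coordinates are padded with 0, so that all networks use the same dimension `k`.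
  refine ⟨fun v t => if ht : (t : ℕ) < j then ((N.distSet v (W ⟨t, ht⟩)).toNat : ℤ) else 0,
    fun u v huv t => ?_, fun z => ?_⟩
  · by_cases ht : (t : ℕ) < j
    · simpa [ht] using N.abs_distSet_sub_le (N.graph_adj_of_arc huv) _
    · simp [ht]
  · rw [servicesAt, Finset.card_product, Finset.card_singleton, one_mul]
    rcases Finset.eq_empty_or_nonempty (Finset.univ.filter fun v : V =>
      (fun t : Fin k => if ht : (t : ℕ) < j then ((N.distSet v (W ⟨t, ht⟩)).toNat : ℤ) else 0) =
        fun t => z (some t)) with he | ⟨v, hv⟩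
    · exact (Finset.card_eq_zero.2 he).trans_le zero_le
    · rw [← ENat.natCast_le_natCast, ← Set.encard_coe_eq_coe_finsetCard]
      refine (Set.encard_le_encard fun u hu => ?_).trans (h v)
      have huv := (Finset.mem_filter.1 (Finset.mem_coe.1 hu)).2.trans (Finset.mem_filter.1 hv).2.symm
      funext t
      have := congrFun huv ⟨t, t.2.trans_le hj⟩
      simp only [t.2, dif_pos, Nat.cast_inj] at this
      exact N.distSet_eq_of_toNat_eq this

theorem exists_labelling_of_minLevel_lt {L : ℕ} (h : N.minLevel < L) :
    ∃ l : V → ℤ, ∀ u v, N.Arc u v → 1 ≤ l v - l u ∧ l v - l u ≤ L := by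
  simp only [minLevel, iInf_lt_iff] at h
  obtain ⟨l, hl, hlt⟩ := h
  refine ⟨l, fun u v huv => ⟨hl u v huv, ?_⟩⟩
  have h1 : ((l v - l u).toNat : ℕ∞) ≤ L :=
    le_trans (le_iSup_of_le u (le_iSup_of_le v
      (le_iSup (fun _ : N.Arc u v => ((l v - l u).toNat : ℕ∞)) huv))) hlt.le
  rw [ENat.natCast_le_natCast] at h1
  exact (Int.self_le_toNat _).trans (by exact_mod_cast h1)

end Coordinates

end ForkJoinNetwork

theorem exists_resolving_of_extendedMetricDim_lt {V : ℕ → Type*} {N : ∀ i, ForkJoinNetwork (V i)}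
    {a : ℝ} (h : ((extendedMetricDim N : ℝ≥0∞) : EReal) < (a : EReal)) :
    ∃ k : ℕ, (k : ℝ) < a ∧ ∃ Λ : ℕ, ∀ i, ∃ j ≤ k, ∃ W : Fin j → Set (V i),
      (N i).IsExtendedResolving Λ W := by
  have htop : extendedMetricDim N ≠ ⊤ := by
    intro htop
    rw [htop] at h
    simp at h
  obtain ⟨n, hn⟩ := ENat.ne_top_iff_exists.1 htop
  -- A strict bound on the infimum yields an admissible k < n + 1, that is, k ≤ n.
  have hlt : extendedMetricDim N < ((n + 1 : ℕ) : ℕ∞) := by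
    rw [← hn, ENat.natCast_lt_natCast]
    exact Nat.lt_succ_self n
  simp only [extendedMetricDim, iInf_lt_iff] at hlt
  obtain ⟨k, ⟨Λ, -, hΛ⟩, hk⟩ := hlt
  rw [ENat.natCast_lt_natCast, Nat.lt_succ_iff] at hk
  refine ⟨k, ?_, Λ, hΛ⟩
  rw [← hn] at h
  have h1 : (n : ℝ) < a := by
    rw [ENat.toENNReal_coe, ← ENNReal.ofReal_natCast, EReal.coe_ennreal_ofReal,
      max_eq_left n.cast_nonneg, EReal.coe_lt_coe_iff] at h
    exact h
  exact lt_of_le_of_lt (by exact_mod_cast hk) h1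

/-- The constants L, k and Λ can be chosen independently of the network, at least from some index
on; hence so can the bound on the time constants, and its inverse is a positive lower bound for the
throughputs. -/
theorem throughputScalable_of_extendedMetricDim_lt {Ω : Type*} [MeasurableSpace Ω] (P : Measure Ω)
    [IsProbabilityMeasure P] {V : ℕ → Type*} [∀ i, Fintype (V i)] (N : ∀ i, ForkJoinNetwork (V i))
    (b : ℕ+) {F : Measure ℝ≥0} [IsProbabilityMeasure F] {α : ℝ} (hα : 1 < α)
    (hF : IsRegularlyVarying F α) {S : ∀ i, ℕ → V i → Ω → ℝ≥0}
    (hS : ∀ i, IIDServices P F (S i))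
    (hlevel : limsup (fun i => (N i).minLevel) atTop < ⊤)
    (h : ((extendedMetricDim N : ℝ≥0∞) : EReal) < ((α - 1 : ℝ) : EReal)) :
    ThroughputScalable P N b S := by
  have hmean := hF.lintegral_ne_top hα
  obtain ⟨k, hk, Λ, hΛ⟩ := exists_resolving_of_extendedMetricDim_lt h
  obtain ⟨L, hL⟩ : ∃ L : ℕ, limsup (fun i => (N i).minLevel) atTop < L := by
    obtain ⟨L, hL⟩ := ENat.ne_top_iff_exists.1 hlevel.ne
    refine ⟨L + 1, ?_⟩
    rw [← hL]
    exact_mod_cast Nat.lt_succ_self L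
  set C : ℝ := (L + 1) * (1 + pathConstant b k Λ * ∑' j : ℕ,
      (2 : ℝ) ^ (j + 1) * F.real {y : ℝ≥0 | (2 : ℝ) ^ j < y} ^ ((1 : ℝ) / (k + 1 : ℕ))) with hC
  have hev : ∀ᶠ i in atTop, (ENNReal.ofReal C)⁻¹ ≤ (N i).throughput P b (S i) := by
    filter_upwards [eventually_lt_of_limsup_lt hL] with i hi
    obtain ⟨l, hl⟩ := (N i).exists_labelling_of_minLevel_lt hi
    obtain ⟨j, hj, W, hW⟩ := hΛ i
    obtain ⟨r, hr, hr'⟩ := hW.exists_coordinates hj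
    obtain ⟨-, γ, hγ, hlim, -⟩ := (hS i).exists_throughput_eq (N i) b hmean
    obtain ⟨v, -⟩ := (N i).univ_nonempty
    have hle := (hS i).timeConstant_le (N i) b hα hF hl hk hr hr' v (hlim v)
    rw [hγ, ENNReal.inv_le_inv, ← ENNReal.ofReal_coe_nnreal]
    exact ENNReal.ofReal_le_ofReal hle
  exact lt_of_lt_of_le (ENNReal.inv_pos.2 ENNReal.ofReal_ne_top)
    (le_liminf_of_le (by isBoundedDefault) hev)

theorem theorem1 {Ω : Type*} [MeasurableSpace Ω] (P : Measure Ω) [IsProbabilityMeasure P]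
    (V : ℕ → Type*) [∀ i, Fintype (V i)] (N : ∀ i, ForkJoinNetwork (V i)) (b : ℕ+)
    (F : Measure ℝ≥0) (α : ℝ) (hα : 1 < α) (hF : IsRegularlyVarying F α)
    (S : ∀ i, ℕ → V i → Ω → ℝ≥0)
    (hS_meas : ∀ i m v, Measurable (S i m v))
    (hS_law : ∀ i m v, P.map (S i m v) = F)
    (hS_indep : ∀ i, iIndepFun (fun p : ℕ × V i => S i p.1 p.2) P)
    (hsize : limsup (fun i => (Fintype.card (V i) : ℕ∞)) atTop = ⊤)
    (hdegree : limsup (fun i => (N i).degree) atTop < ⊤)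
    (hlevel : limsup (fun i => (N i).minLevel) atTop < ⊤) :
    (∀ i, (N i).ThroughputWellDefined P b (S i)) ∧
    (((extendedMetricDim N : ℝ≥0∞) : EReal) < ((α - 1 : ℝ) : EReal) →
      ThroughputScalable P N b S) ∧
    (ThroughputScalable P N b S → scalingDim N ≤ ((α - 1 : ℝ) : EReal)) := by
  have hS : ∀ i, IIDServices P F (S i) := fun i => ⟨hS_meas i, hS_law i, hS_indep i⟩
  -- A node is needed to see that `F`, as the law of a service time, is a probability measure.
  have : Nonempty (V 0) := (N 0).connected.nonempty
  have := (hS 0).isProbabilityMeasure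
  have hmean := hF.lintegral_ne_top hα
  exact ⟨fun i => ((hS i).exists_throughput_eq (N i) b hmean).1,
    throughputScalable_of_extendedMetricDim_lt P N b hα hF hS hlevel,
    scalingDim_le_of_throughputScalable P N b hα hF hS⟩
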